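/- Let $V$ be a finite-dimensional Euclidean space and $(W,S)$ a finite Coxeter system acting essentially on $V$ as a reflection group: $W$ is the finite group generated by the set $S$ of simple reflections, i.e. the orthogonal reflections in the walls of a fixed (fundamental) chamber $\mathcal C$, and the simple roots $\{\alpha_s\}_{s\in S}$ form a basis of $V$, where $\alpha_s$ is a vector (of arbitrary positive length) orthogonal to the hyperplane of $s$ and pointing towards $\mathcal C$. Let $\{\omega_s\}_{s\in S}$ be the fundamental weights, defined by $\langle\alpha_s,\omega_t\rangle=\delta_{s=t}\langle\alpha_s,\alpha_s\rangle/2$, let $\ell$ be the length function of $(W,S)$ and $w_\circ$ the longest element of $W$. Let $Q=q_1\cdots q_m$ be a word in $S$ whose Demazure product is $w_\circ$; the Demazure product $\delta$ is defined by $\delta(\varepsilon)=e$ and, with $w=\delta(Q')$, $\delta(Q's)=ws$ if $\ell(ws)=\ell(w)+1$ and $\delta(Q's)=w$ otherwise. Let $SC(Q)$ be the subword complex of $Q$: its faces are the subsets of $[m]$ (the empty set included) whose complement contains (the positions of) a reduced expression of $w_\circ$; its facets are its maximal faces. For a facet $I$ and $k\in[m]$ let $\sigma_I^{[1,k-1]}$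 be the product of the $q_z$ with $z<k$, $z\notin I$, in this order, and put $r(I,k)=\sigma_I^{[1,k-1]}(\alpha_{q_k})$ and $w(I,k)=\sigma_I^{[1,k-1]}(\omega_{q_k})$. The root configuration of $I$ is the family $(r(I,i))_{i\in I}$, the brick vector of $I$ is $B(I)=\sum_{k\in[m]}w(I,k)$, and the brick polytope is $B(Q)=\mathrm{conv}\{B(I) : I \text{ facet of } SC(Q)\}$. Suppose that $Q$ is realizing, i.e. that the root configuration of some facet of $SC(Q)$ is a linear basis of $V$. Then: 1. the root configuration of every facet of $SC(Q)$ is a linear basis of $V$; 2. $B(Q)$ is full-dimensional, and its polar realizes $SC(Q)$: for every interior point $p$ of $B(Q)$, the polar $\{y\in V : \langle y,x-p\rangle\le 1 \text{ for all } x\in B(Q)\}$ of the translate $B(Q)-p$ is a polytope, and the poset of its proper faces (the empty face included) is isomorphic to the poset of faces of $SC(Q)$; 3. the brick vector of every facet of $SC(Q)$ is a vertex of $B(Q)$, and the polytope $B(Q)$ is simple (each of its vertices lies in exactly $\dim B(Q)$ facets); 4. the boundary complex of $B(Q)$ is dual to $SC(Q)$: there is an order-reversing bijection from the faces of $SC(Q)$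 to the nonempty faces of $B(Q)$ ($B(Q)$ itself included, corresponding to the empty set) that maps every facet $I$ of $SC(Q)$ to the vertex $\{B(I)\}$. -/

import Mathlib

open scoped InnerProductSpace

noncomputable section

/-! ### Finite Coxeter groups acting on a Euclidean space -/

/-- The orthogonal reflection exchanging `v` and `-v` and fixing the hyperplane orthogonal to `v`
pointwise (it is the identity if `v = 0`). -/
def reflectionAlong {V : Type*} [NormedAddCommGroup V] [InnerProductSpace ℝ V] (v : V) :
    V ≃ₗᵢ[ℝ] V :=
  (Submodule.span ℝ {v})ᗮ.reflection

/-- A finite Coxeter system `(W, S)` acting essentially on the Euclidean space `V`, together with a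
choice of simple roots. The set `ι` indexes the simple reflections. The simple roots `α s` form a
basis of `V`, the group `W` generated by the reflections along them is finite, and the open cone
`{x | ∀ s, 0 < ⟪α s, x⟫}` is the interior of a chamber of `W`. Since the walls of this cone are
reflecting hyperplanes of `W`, the latter says that no reflecting hyperplane of `W` meets the cone.

The lengths of the simple roots are arbitrary: they correspond to the choice of the generalized
Cartan matrix `a s t = 2 * ⟪α s, α t⟫ / ⟪α s, α s⟫`, for which the simple reflection `s` maps `α t`
to `α t - a s t • α s`. -/
structure FiniteCoxeterSystem (ι V : Type*) [NormedAddCommGroup V] [InnerProductSpace ℝ V] where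
  /-- the simple roots -/
  root : Module.Basis ι ℝ V
  /-- the group generated by the simple reflections is finite -/
  finite : Finite (Subgroup.closure (Set.range fun s : ι => reflectionAlong (root s)))
  /-- the hyperplanes orthogonal to the simple roots bound a chamber -/
  chamber : ∀ v : V, v ≠ 0 →
    reflectionAlong v ∈ Subgroup.closure (Set.range fun s : ι => reflectionAlong (root s)) →
    ∀ x : V, (∀ s : ι, 0 < ⟪root s, x⟫_ℝ) → reflectionAlong v x ≠ x

namespace FiniteCoxeterSystem

variable {ι V : Type*} [NormedAddCommGroup V] [InnerProductSpace ℝ V]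

/-- The finite Coxeter group `W`, generated by the simple reflections. -/
def group (C : FiniteCoxeterSystem ι V) : Subgroup (V ≃ₗᵢ[ℝ] V) :=
  Subgroup.closure (Set.range fun s : ι => reflectionAlong (C.root s))

instance (C : FiniteCoxeterSystem ι V) : Finite C.group := C.finite

/-- The simple reflections, as elements of `W`. -/
def simple (C : FiniteCoxeterSystem ι V) (s : ι) : C.group :=
  ⟨reflectionAlong (C.root s), Subgroup.subset_closure ⟨s, rfl⟩⟩

/-- The fundamental weights: the dual basis, with respect to the inner product, to the basis
`2 / ⟪α s, α s⟫ • α s`. Equivalently, `⟪α s, ω t⟫ = ⟪α s, α s⟫ / 2` if `s = t`, and it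
is `0` otherwise. -/
def weight [Finite ι] [DecidableEq ι] (C : FiniteCoxeterSystem ι V) : ι → V :=
  LinearMap.BilinForm.dualBasis (innerₗ V)
    (LinearMap.IsRefl.nondegenerate_iff_separatingLeft
      (fun x y h => by simpa [real_inner_comm] using h) |>.2
      (fun x hx => inner_self_eq_zero.1 (hx x)))
    (C.root.isUnitSMul (w := fun s => 2 / ⟪C.root s, C.root s⟫_ℝ) fun s =>
      IsUnit.mk0 _ (div_ne_zero two_ne_zero (inner_self_ne_zero.2 (C.root.ne_zero s))))

/-- The element of `W` which is the product of the letters of a word, in this order. -/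
def wordProd (C : FiniteCoxeterSystem ι V) (w : List ι) : C.group :=
  (w.map C.simple).prod

/-- The length of an element of `W`: the smallest length of an expression of it as a product of
simple reflections. -/
def length (C : FiniteCoxeterSystem ι V) (w : C.group) : ℕ :=
  sInf {n | ∃ l : List ι, l.length = n ∧ C.wordProd l = w}

/-- A word is reduced if its number of letters is the length of its product. -/
def IsReduced (C : FiniteCoxeterSystem ι V) (l : List ι) : Prop :=
  l.length = C.length (C.wordProd l)

/-- The longest element of `W`: an element of maximal length. -/
def longest (C : FiniteCoxeterSystem ι V) : C.group :=
  Classical.choose (Finite.exists_max C.length)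

/-- The Demazure product of a word: `δ(ε) = e`, and `δ(Q s)` is `δ(Q) s` if this element is longer
than `δ(Q)`, and `δ(Q)` otherwise. -/
def demazure (C : FiniteCoxeterSystem ι V) (Q : List ι) : C.group :=
  Q.foldl (fun w s => if C.length (w * C.simple s) = C.length w + 1 then w * C.simple s else w) 1

/-! ### Subword complexes -/

/-- The subword of `Q` formed by the letters whose positions lie in `P`. -/
def subword (Q : List ι) (P : Finset (Fin Q.length)) : List ι :=
  ((List.finRange Q.length).filter (fun k => k ∈ P)).map Q.get

/-- The subword complex `SC(Q, ρ)`, given by its set of faces: the sets of positions in `Q` (the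
empty set included) whose complement contains a reduced expression of `ρ`. -/
def subwordComplex (C : FiniteCoxeterSystem ι V) (Q : List ι) (ρ : C.group) :
    Set (Finset (Fin Q.length)) :=
  {F | ∃ P ⊆ Fᶜ, C.IsReduced (subword Q P) ∧ C.wordProd (subword Q P) = ρ}

/-- The subword complex `SC(Q) = SC(Q, w₀)`, where `w₀` is the longest element of `W`. -/
def sphericalSubwordComplex (C : FiniteCoxeterSystem ι V) (Q : List ι) :
    Set (Finset (Fin Q.length)) :=
  C.subwordComplex Q C.longest

/-- The facets of `SC(Q)`: its inclusion-maximal faces. -/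
def IsFacet (C : FiniteCoxeterSystem ι V) (Q : List ι) (I : Finset (Fin Q.length)) : Prop :=
  Maximal (fun F => F ∈ C.sphericalSubwordComplex Q) I

/-! ### Root configurations and brick polytopes -/

/-- The product of the reflections `q_z`, for the positions `z < k` not in `I`, in this order. -/
def prefixProd (C : FiniteCoxeterSystem ι V) (Q : List ι) (I : Finset (Fin Q.length))
    (k : Fin Q.length) : C.group :=
  C.wordProd (subword Q (Finset.univ.filter fun z => z < k ∧ z ∉ I))

/-- The root function of `I`. -/
def rootFunction (C : FiniteCoxeterSystem ι V) (Q : List ι) (I : Finset (Fin Q.length))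
    (k : Fin Q.length) : V :=
  (C.prefixProd Q I k : V ≃ₗᵢ[ℝ] V) (C.root (Q.get k))

/-- The weight function of `I`. -/
def weightFunction [Finite ι] [DecidableEq ι] (C : FiniteCoxeterSystem ι V) (Q : List ι)
    (I : Finset (Fin Q.length)) (k : Fin Q.length) : V :=
  (C.prefixProd Q I k : V ≃ₗᵢ[ℝ] V) (C.weight (Q.get k))

/-- The root configuration of `I` is a linear basis of `V`. The root configuration is the family
(with repetitions) of the roots of `I` at the positions in `I`. -/
def RootConfigurationIsBasis (C : FiniteCoxeterSystem ι V) (Q : List ι)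
    (I : Finset (Fin Q.length)) : Prop :=
  LinearIndependent ℝ (fun i : I => C.rootFunction Q I i) ∧
    Submodule.span ℝ (Set.range fun i : I => C.rootFunction Q I i) = ⊤

/-- The word `Q` is realizing: the root configuration of some facet of `SC(Q)` is a linear basis
of `V`. -/
def IsRealizing (C : FiniteCoxeterSystem ι V) (Q : List ι) : Prop :=
  ∃ I, C.IsFacet Q I ∧ C.RootConfigurationIsBasis Q I

/-- The brick vector of `I`. -/
def brickVector [Finite ι] [DecidableEq ι] (C : FiniteCoxeterSystem ι V) (Q : List ι)
    (I : Finset (Fin Q.length)) : V :=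
  ∑ k, C.weightFunction Q I k

/-- The brick polytope of `Q`: the convex hull of the brick vectors of the facets of `SC(Q)`. -/
def brickPolytope [Finite ι] [DecidableEq ι] (C : FiniteCoxeterSystem ι V) (Q : List ι) : Set V :=
  convexHull ℝ {x | ∃ I, C.IsFacet Q I ∧ C.brickVector Q I = x}

end FiniteCoxeterSystem

/-! ### Polytopes -/

section Polytope

variable {V : Type*} [NormedAddCommGroup V] [InnerProductSpace ℝ V]

/-- A polytope is the convex hull of a finite set. -/
def IsPolytope (P : Set V) : Prop :=
  ∃ X : Set V, X.Finite ∧ convexHull ℝ X = P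

/-- The proper faces of a polytope, ordered by inclusion; the empty face is one of them. A face is
the empty set or the set of points of `P` where a linear functional attains its maximum on `P`. -/
abbrev ProperFace (P : Set V) : Type _ := {F : Set V // IsExposed ℝ P F ∧ F ≠ P}

/-- The nonempty faces of a polytope, ordered by inclusion; `P` itself is one of them. -/
abbrev NonemptyFace (P : Set V) : Type _ := {F : Set V // IsExposed ℝ P F ∧ F.Nonempty}

/-- A facet of a polytope is a maximal proper face. -/
def IsPolytopeFacet (P F : Set V) : Prop :=
  Maximal (fun G => IsExposed ℝ P G ∧ G ≠ P) F

/-- A polytope of dimension `d` is simple if each of its vertices lies in exactly `d` facets. -/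
def IsSimplePolytope (P : Set V) : Prop :=
  IsPolytope P ∧ ∀ x ∈ P.extremePoints ℝ,
    {F : Set V | IsPolytopeFacet P F ∧ x ∈ F}.encard = Module.finrank ℝ (vectorSpan ℝ P)

/-- The polar of `P` with respect to the point `p`, that is, the polar of the translate `P - p`. -/
def polarAt (P : Set V) (p : V) : Set V :=
  {y | ∀ x ∈ P, ⟪y, x - p⟫_ℝ ≤ 1}

/-- The polytope `P` realizes the simplicial complex with set of faces `K` (the empty face included):
the complex `K` is isomorphic to the boundary complex of `P`. -/
def RealizesComplex {α : Type*} (P : Set V) (K : Set (Finset α)) : Prop :=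
  IsPolytope P ∧ Nonempty (K ≃o ProperFace P)

end Polytope

end

/-! The normal fan of the brick polytope is a complete simplicial fan: its maximal cones are dual to
the root configurations, and its underlying complex is SC(Q).

The complement of a facet I spells a reduced word of w₀, so the roots at positions outside I meet
every positive root direction exactly once. Hence each i in I has a unique partner j outside I with
proportional root, and exchanging the two gives a facet J (`IsFacet.exists_isFlip`). This flip adds
multiples of r(I,i) to the roots, makes the new root a negative multiple of r(I,i), and subtracts a
positive multiple of r(I,i) from the brick vector. Facets containing a fixed face are connected by
flips (`eq_of_isFlip_invariant`). So all root configurations span the same space, and all are bases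
once one is; likewise the vector dual to the root at i is common to all facets containing i, which
gives one ray per position (`rayVector`).

If B(I) maximizes a functional f, the flips of I show that f is nonnegative on the root
configuration of I, i.e. f lies in the cone on the rays of I; thus the cones cover V. The converse
(`IsRealizing.inner_brickVector_le`) rests on the fact that a generic functional is positive on at
most one root configuration. Placing it in a chamber of w, this says that at most one root
configuration lies in the w-image of the positive roots (`IsRealizing.eq_of_isPositiveFor`), which
follows by induction on a word for w: passing from ws to w costs at most one flip. A perturbation
argument then shows that B(J) maximizes the ray of i only if i lies in J.

The rest is convex geometry, isolated in `SimplicialFanPolytope`: tight ray inequalities describe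
the faces of the polytope and, after rescaling, the rays become the vertices of its polar. -/

set_option linter.unusedSectionVars false

noncomputable section

/-! ### Polytopes described by a complete simplicial fan -/

/-- A point configuration indexed by the facets of a pure simplicial complex, together with the
rays of a complete simplicial fan with the same underlying complex, such that the inequality
`⟪ray i, x⟫ ≤ height i` is tight exactly at the points of the facets containing `i`. -/
structure SimplicialFanPolytope (α V : Type*) [NormedAddCommGroup V] [InnerProductSpace ℝ V] where
  facets : Set (Finset α)
  point : Finset α → V
  ray : α → V
  height : α → ℝ
  nonempty : facets.Nonempty
  card_eq : ∀ I ∈ facets, I.card = Module.finrank ℝ V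
  span_eq : ∀ I ∈ facets, Submodule.span ℝ (ray '' I) = ⊤
  le_height : ∀ I ∈ facets, ∀ i ∈ I, ∀ J ∈ facets, ⟪ray i, point J⟫_ℝ ≤ height i
  eq_height_iff : ∀ I ∈ facets, ∀ i ∈ I, ∀ J ∈ facets, ⟪ray i, point J⟫_ℝ = height i ↔ i ∈ J
  exists_cone : ∀ y : V, ∃ I ∈ facets, ∃ c : α → ℝ, (∀ i, 0 ≤ c i) ∧ y = ∑ i ∈ I, c i • ray i
  -- This separates faces: it makes both face maps reflect inclusions and makes each ray inequality
  -- strict at some vertex.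
  exists_notMem : ∀ I ∈ facets, ∀ G ⊆ I, ∀ i, i ∉ G → ∃ J ∈ facets, G ⊆ J ∧ i ∉ J

namespace SimplicialFanPolytope

variable {α V : Type*} [NormedAddCommGroup V] [InnerProductSpace ℝ V]
  (D : SimplicialFanPolytope α V)

/-- The faces of the simplicial complex. -/
def faces : Set (Finset α) := {F | ∃ I ∈ D.facets, F ⊆ I}

/-- The convex hull of the points of the configuration. -/
def polytope : Set V := convexHull ℝ (D.point '' D.facets)

/-- The face of the polytope on which the inequalities indexed by `F` are tight. -/
def face (F : Finset α) : Set V := {x | x ∈ D.polytope ∧ ∀ i ∈ F, ⟪D.ray i, x⟫_ℝ = D.height i}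

variable {D}

/-! ### Faces of the polytope -/

lemma point_mem {I : Finset α} (hI : I ∈ D.facets) : D.point I ∈ D.polytope :=
  subset_convexHull _ _ ⟨I, hI, rfl⟩

lemma point_mem_face_iff {I F : Finset α} (hI : I ∈ D.facets) (hF : F ∈ D.faces) :
    D.point I ∈ D.face F ↔ F ⊆ I := by
  obtain ⟨J, hJ, hFJ⟩ := hF
  constructor
  · intro h i hi
    exact (D.eq_height_iff J hJ i (hFJ hi) I hI).1 (h.2 i hi)
  · intro h
    exact ⟨point_mem hI, fun i hi => (D.eq_height_iff I hI i (h hi) I hI).2 (h hi)⟩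

lemma inner_le_of_forall_point {y : V} {a : ℝ} (h : ∀ I ∈ D.facets, ⟪y, D.point I⟫_ℝ ≤ a) {x : V}
    (hx : x ∈ D.polytope) : ⟪y, x⟫_ℝ ≤ a := by
  have : D.polytope ⊆ {x | innerₗ V y x ≤ a} := by
    refine convexHull_min ?_ (convex_halfSpace_le (innerₗ V y).isLinear a)
    rintro _ ⟨I, hI, rfl⟩
    exact h I hI
  exact this hx

lemma inner_le_height {I : Finset α} (hI : I ∈ D.facets) {i : α} (hi : i ∈ I) {x : V}
    (hx : x ∈ D.polytope) : ⟪D.ray i, x⟫_ℝ ≤ D.height i :=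
  inner_le_of_forall_point (D.le_height I hI i hi) hx

lemma face_subset_face_iff {F G : Finset α} (hF : F ∈ D.faces) (hG : G ∈ D.faces) :
    D.face G ⊆ D.face F ↔ F ⊆ G := by
  constructor
  · intro h i hi
    by_contra hiG
    obtain ⟨I, hI, hGI⟩ := hG
    obtain ⟨J, hJ, hGJ, hiJ⟩ := D.exists_notMem I hI G hGI i hiG
    exact hiJ ((point_mem_face_iff hJ hF).1 (h ((point_mem_face_iff hJ ⟨I, hI, hGI⟩).2 hGJ)) hi)
  · exact fun h x hx => ⟨hx.1, fun i hi => hx.2 i (h hi)⟩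

lemma face_nonempty {F : Finset α} (hF : F ∈ D.faces) : (D.face F).Nonempty := by
  obtain ⟨I, hI, h⟩ := hF
  exact ⟨D.point I, (point_mem_face_iff hI ⟨I, hI, h⟩).2 h⟩

lemma empty_mem_faces : ∅ ∈ D.faces := by
  obtain ⟨I, hI⟩ := D.nonempty
  exact ⟨I, hI, by simp⟩

lemma face_empty : D.face ∅ = D.polytope := by
  ext x; simp [face]

/-- The face maximizing a nonnegative combination of rays of a facet. -/
lemma maximizers_eq_face {I : Finset α} (hI : I ∈ D.facets) {c : α → ℝ} (hc : ∀ i, 0 ≤ c i) :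
    {x ∈ D.polytope | ∀ z ∈ D.polytope,
      ⟪∑ i ∈ I, c i • D.ray i, z⟫_ℝ ≤ ⟪∑ i ∈ I, c i • D.ray i, x⟫_ℝ} =
      D.face (I.filter fun i => c i ≠ 0) := by
  have key : ∀ x, ⟪∑ i ∈ I, c i • D.ray i, x⟫_ℝ = ∑ i ∈ I, c i * ⟪D.ray i, x⟫_ℝ := by
    intro x
    simp [sum_inner, inner_smul_left]
  have hle : ∀ x ∈ D.polytope, ∀ i ∈ I, c i * ⟪D.ray i, x⟫_ℝ ≤ c i * D.height i :=
    fun x hx i hi => mul_le_mul_of_nonneg_left (inner_le_height hI hi hx) (hc i)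
  ext x
  simp only [key, Set.mem_ofPred_eq, face, Finset.mem_filter]
  refine and_congr_right fun hx => ⟨fun h i hi => ?_, fun h z hz => ?_⟩
  -- The vertex of `I` attains the upper bound in every term, so a maximizer must do so in every
  -- term with nonzero coefficient.
  · have h1 := h _ (point_mem hI)
    have h2 : ∑ i ∈ I, c i * ⟪D.ray i, D.point I⟫_ℝ = ∑ i ∈ I, c i * D.height i :=
      Finset.sum_congr rfl fun i hi => by rw [(D.eq_height_iff I hI i hi I hI).2 hi]
    have h3 := (Finset.sum_eq_sum_iff_of_le (hle x hx)).1
      (le_antisymm (Finset.sum_le_sum (hle x hx)) (h2 ▸ h1)) i hi.1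
    exact mul_left_cancel₀ hi.2 h3
  · refine (Finset.sum_le_sum (hle z hz)).trans (le_of_eq (Finset.sum_congr rfl fun i hi => ?_))
    by_cases hci : c i = 0
    · simp [hci]
    · rw [h i ⟨hi, hci⟩]

lemma isExposed_face {F : Finset α} (hF : F ∈ D.faces) : IsExposed ℝ D.polytope (D.face F) := by
  classical
  intro _
  obtain ⟨I, hI, hFI⟩ := hF
  refine ⟨innerSL ℝ (∑ i ∈ I, (if i ∈ F then (1 : ℝ) else 0) • D.ray i), ?_⟩
  have h := maximizers_eq_face hI (c := fun i => if i ∈ F then (1 : ℝ) else 0)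
    (fun i => by split_ifs <;> norm_num)
  have h2 : (I.filter fun i => (if i ∈ F then (1 : ℝ) else 0) ≠ 0) = F := by
    ext i
    simp only [Finset.mem_filter, ne_eq, ite_eq_right_iff, one_ne_zero, imp_false, not_not]
    exact ⟨fun h => h.2, fun h => ⟨hFI h, h⟩⟩
  rw [h2] at h
  rw [← h]
  rfl

variable [FiniteDimensional ℝ V]

lemma exists_face_eq {A : Set V} (hA : IsExposed ℝ D.polytope A) (hne : A.Nonempty) :
    ∃ F ∈ D.faces, D.face F = A := by
  obtain ⟨l, rfl⟩ := hA hne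
  obtain ⟨y, rfl⟩ := (InnerProductSpace.toDual ℝ V).surjective l
  obtain ⟨I, hI, c, hc, rfl⟩ := D.exists_cone y
  exact ⟨_, ⟨I, hI, Finset.filter_subset _ _⟩, (maximizers_eq_face hI hc).symm⟩

/-- The faces of the complex are dual to the nonempty faces of the polytope. -/
def faceOrderIso (D : SimplicialFanPolytope α V) : D.faces ≃o (NonemptyFace D.polytope)ᵒᵈ :=
  RelIso.ofSurjective
    (OrderEmbedding.ofMapLEIff
      (fun F : D.faces => OrderDual.toDual
        (⟨D.face F.1, isExposed_face F.2, face_nonempty F.2⟩ : NonemptyFace D.polytope))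
      fun F G => face_subset_face_iff F.2 G.2)
    fun A => by
      obtain ⟨F, hF, h⟩ := exists_face_eq A.ofDual.2.1 A.ofDual.2.2
      exact ⟨⟨F, hF⟩, congrArg OrderDual.toDual (Subtype.ext h)⟩

/-- The rays of `I` span, so their tight equations have only one solution. -/
lemma face_facet {I : Finset α} (hI : I ∈ D.facets) : D.face I = {D.point I} := by
  refine Set.eq_singleton_iff_unique_mem.2 ⟨(point_mem_face_iff hI ⟨I, hI, subset_rfl⟩).2 subset_rfl,
    fun x hx => ?_⟩
  have h : Submodule.span ℝ (D.ray '' I) ≤ (ℝ ∙ (x - D.point I))ᗮ := by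
    rw [Submodule.span_le]
    rintro _ ⟨i, hi, rfl⟩
    rw [SetLike.mem_coe, Submodule.mem_orthogonal_singleton_iff_inner_left, inner_sub_right,
      hx.2 i hi, (D.eq_height_iff I hI i hi I hI).2 hi, sub_self]
  rw [D.span_eq I hI] at h
  have h2 : x - D.point I ∈ (ℝ ∙ (x - D.point I))ᗮ := h trivial
  rw [Submodule.mem_orthogonal_singleton_iff_inner_left, inner_self_eq_zero, sub_eq_zero] at h2
  exact h2

lemma point_mem_extremePoints {I : Finset α} (hI : I ∈ D.facets) :
    D.point I ∈ D.polytope.extremePoints ℝ := by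
  have h := isExposed_face (D := D) ⟨I, hI, subset_rfl⟩
  rw [face_facet hI] at h
  exact h.isExtreme.mem_extremePoints

/-- A nonzero vector orthogonal to all differences would lie in the cone of some `I`. A vertex of a
facet avoiding an index with positive coefficient then has strictly smaller pairing than the vertex
of `I`. -/
lemma vectorSpan_polytope : vectorSpan ℝ D.polytope = ⊤ := by
  by_contra hne
  obtain ⟨y, hy, hy0⟩ := (Submodule.ne_bot_iff _).1
    (mt (Submodule.orthogonal_eq_bot_iff (K := vectorSpan ℝ D.polytope)).1 hne)
  obtain ⟨I, hI, c, hc, rfl⟩ := D.exists_cone y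
  obtain ⟨i, hi, hci⟩ := Finset.exists_ne_zero_of_sum_ne_zero hy0
  obtain ⟨J, hJ, -, hiJ⟩ := D.exists_notMem I hI ∅ (by simp) i (by simp)
  have h := (Submodule.mem_orthogonal' _ _).1 hy _
    (vsub_mem_vectorSpan ℝ (point_mem hI) (point_mem hJ))
  have hpos : 0 < c i := (hc i).lt_of_ne' fun h0 => hci (by simp [h0])
  simp only [vsub_eq_sub, sum_inner, inner_smul_left, RCLike.conj_to_real] at h
  refine absurd h (ne_of_gt (Finset.sum_pos' (fun k hk => mul_nonneg (hc k) ?_)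
    ⟨i, hi, mul_pos hpos ?_⟩))
  · rw [inner_sub_right, (D.eq_height_iff I hI k hk I hI).2 hk, sub_nonneg]
    exact D.le_height I hI k hk J hJ
  · rw [inner_sub_right, (D.eq_height_iff I hI i hi I hI).2 hi, sub_pos]
    exact (D.le_height I hI i hi J hJ).lt_of_ne (mt (D.eq_height_iff I hI i hi J hJ).1 hiJ)

lemma interior_polytope_nonempty : (interior D.polytope).Nonempty := by
  refine (Convex.interior_nonempty_iff_affineSpan_eq_top (convex_convexHull ℝ _)).2 ?_
  obtain ⟨I, hI⟩ := D.nonempty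
  exact (AffineSubspace.affineSpan_eq_top_iff_vectorSpan_eq_top_of_nonempty ℝ V V
    ⟨_, point_mem hI⟩).2 vectorSpan_polytope

lemma isPolytopeFacet_iff {A : Set V} {I : Finset α} (hI : I ∈ D.facets) :
    IsPolytopeFacet D.polytope A ∧ D.point I ∈ A ↔ ∃ i ∈ I, D.face {i} = A := by
  have hsing : ∀ i ∈ I, ({i} : Finset α) ∈ D.faces := fun i hi => ⟨I, hI, by simpa using hi⟩
  have hproper : ∀ i ∈ I, IsExposed ℝ D.polytope (D.face {i}) ∧ D.face {i} ≠ D.polytope := by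
    refine fun i hi => ⟨isExposed_face (hsing i hi), fun h => ?_⟩
    have h2 := (face_subset_face_iff (hsing i hi) empty_mem_faces).1
      (by rw [face_empty]; exact h.ge)
    simp at h2
  constructor
  · rintro ⟨hA, hIA⟩
    obtain ⟨F, hF, rfl⟩ := exists_face_eq hA.prop.1 ⟨_, hIA⟩
    have hFne : F.Nonempty := by
      rw [Finset.nonempty_iff_ne_empty]
      rintro rfl
      exact hA.prop.2 face_empty
    obtain ⟨i, hi⟩ := hFne
    have hiI : i ∈ I := (point_mem_face_iff hI hF).1 hIA hi
    have hle : D.face F ⊆ D.face {i} :=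
      (face_subset_face_iff (hsing i hiI) hF).2 (by simpa using hi)
    exact ⟨i, hiI, Set.Subset.antisymm (hA.le_of_ge (hproper i hiI) hle) hle⟩
  · rintro ⟨i, hi, rfl⟩
    refine ⟨⟨hproper i hi, fun A hA hle => ?_⟩,
      (point_mem_face_iff hI (hsing i hi)).2 (by simpa using hi)⟩
    obtain ⟨F, hF, rfl⟩ := exists_face_eq hA.1 ((face_nonempty (hsing i hi)).mono hle)
    have hFi := (face_subset_face_iff hF (hsing i hi)).1 hle
    rcases Finset.subset_singleton_iff.1 hFi with rfl | rfl
    · exact absurd face_empty hA.2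
    · exact subset_rfl

variable [Finite α]

lemma isPolytope_polytope : IsPolytope D.polytope :=
  ⟨_, (Set.toFinite D.facets).image _, rfl⟩

lemma isSimplePolytope : IsSimplePolytope D.polytope := by
  refine ⟨isPolytope_polytope, fun x hx => ?_⟩
  obtain ⟨I, hI, rfl⟩ := extremePoints_convexHull_subset hx
  have h : {A : Set V | IsPolytopeFacet D.polytope A ∧ D.point I ∈ A} =
      (fun i => D.face {i}) '' (I : Set α) := by
    ext A
    exact isPolytopeFacet_iff hI
  have hinj : Set.InjOn (fun i => D.face {i}) (I : Set α) := by
    intro i hi j hj hij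
    have h2 := (face_subset_face_iff (D := D) (F := {j}) (G := {i}) ⟨I, hI, by simpa using hj⟩
      ⟨I, hI, by simpa using hi⟩).1 (le_of_eq hij)
    simpa using (Finset.singleton_subset_singleton.1 h2).symm
  rw [h, hinj.encard_image, Set.encard_coe_eq_coe_finsetCard, D.card_eq I hI, vectorSpan_polytope,
    finrank_top]

/-! ### The polar polytope -/

/-- An interior point can be pushed a little along the ray without leaving the polytope. The ray is
nonzero, since some vertex is not tight for it. -/
lemma inner_lt_height {p : V} (hp : p ∈ interior D.polytope) {I : Finset α} (hI : I ∈ D.facets)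
    {i : α} (hi : i ∈ I) : ⟪D.ray i, p⟫_ℝ < D.height i := by
  obtain ⟨J, hJ, -, hiJ⟩ := D.exists_notMem I hI ∅ (by simp) i (by simp)
  have hne : D.ray i ≠ 0 := by
    intro h0
    have h1 := (D.eq_height_iff I hI i hi I hI).2 hi
    rw [h0, inner_zero_left] at h1
    exact hiJ ((D.eq_height_iff I hI i hi J hJ).1 (by rw [h0, inner_zero_left, h1]))
  have hcont : Filter.Tendsto (fun t : ℝ => p + t • D.ray i) (nhdsWithin 0 (Set.Ioi 0)) (nhds p) := by
    have : Continuous (fun t : ℝ => p + t • D.ray i) := by fun_prop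
    have h := (this.tendsto 0).mono_left (nhdsWithin_le_nhds (s := Set.Ioi 0))
    simpa using h
  obtain ⟨t, ht, ht0⟩ := ((hcont.eventually (mem_interior_iff_mem_nhds.1 hp)).and
    self_mem_nhdsWithin).exists
  have h := inner_le_height hI hi ht
  rw [inner_add_right, inner_smul_right] at h
  have h2 : 0 < t * ⟪D.ray i, D.ray i⟫_ℝ := mul_pos ht0 (real_inner_self_pos.2 hne)
  linarith

variable (D) in
/-- The vertices of the polar polytope. -/
def dualVertex (p : V) (i : α) : V := (D.height i - ⟪D.ray i, p⟫_ℝ)⁻¹ • D.ray i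

variable {p : V}

lemma inner_dualVertex_le (hp : p ∈ interior D.polytope) {I : Finset α} (hI : I ∈ D.facets)
    {i : α} (hi : i ∈ I) {x : V} (hx : x ∈ D.polytope) : ⟪D.dualVertex p i, x - p⟫_ℝ ≤ 1 := by
  have h1 := sub_pos.2 (inner_lt_height hp hI hi)
  rw [dualVertex, inner_smul_left, RCLike.conj_to_real, inv_mul_le_one₀ h1, inner_sub_right]
  linarith [inner_le_height hI hi hx]

lemma inner_dualVertex_eq_iff (hp : p ∈ interior D.polytope) {I : Finset α} (hI : I ∈ D.facets)
    {i : α} (hi : i ∈ I) {J : Finset α} (hJ : J ∈ D.facets) :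
    ⟪D.dualVertex p i, D.point J - p⟫_ℝ = 1 ↔ i ∈ J := by
  have h1 := sub_pos.2 (inner_lt_height hp hI hi)
  rw [dualVertex, inner_smul_left, RCLike.conj_to_real, inv_mul_eq_one₀ h1.ne', inner_sub_right,
    ← D.eq_height_iff I hI i hi J hJ, sub_left_inj, eq_comm]

lemma zero_mem_polarAt (P : Set V) : (0 : V) ∈ polarAt P p := fun x _ => by simp

lemma convex_polarAt (P : Set V) : Convex ℝ (polarAt P p) := by
  intro y hy z hz a b ha hb hab x hx
  rw [inner_add_left, inner_smul_left, inner_smul_left, RCLike.conj_to_real, RCLike.conj_to_real]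
  nlinarith [hy x hx, hz x hx]

lemma dualVertex_mem (hp : p ∈ interior D.polytope) {I : Finset α} (hI : I ∈ D.facets)
    {i : α} (hi : i ∈ I) : D.dualVertex p i ∈ polarAt D.polytope p :=
  fun _ hx => inner_dualVertex_le hp hI hi hx

lemma exists_cone_dualVertex (hp : p ∈ interior D.polytope) (y : V) :
    ∃ I ∈ D.facets, ∃ c : α → ℝ, (∀ i ∈ I, 0 ≤ c i) ∧ y = ∑ i ∈ I, c i • D.dualVertex p i := by
  obtain ⟨I, hI, c, hc, rfl⟩ := D.exists_cone y
  refine ⟨I, hI, fun i => c i * (D.height i - ⟪D.ray i, p⟫_ℝ), fun i hi =>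
    mul_nonneg (hc i) (sub_pos.2 (inner_lt_height hp hI hi)).le, Finset.sum_congr rfl fun i hi => ?_⟩
  rw [dualVertex, smul_smul, mul_inv_cancel_right₀ (sub_pos.2 (inner_lt_height hp hI hi)).ne']

/-- Each dual vertex of `I` pairs to 1 with the translated vertex of `I`, so this vertex reads off
the sum of the coefficients. -/
lemma exists_sum_le_one (hp : p ∈ interior D.polytope) {y : V} (hy : y ∈ polarAt D.polytope p) :
    ∃ I ∈ D.facets, ∃ c : α → ℝ, (∀ i ∈ I, 0 ≤ c i) ∧ y = ∑ i ∈ I, c i • D.dualVertex p i ∧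
      ∑ i ∈ I, c i ≤ 1 := by
  obtain ⟨I, hI, c, hc, rfl⟩ := exists_cone_dualVertex hp y
  refine ⟨I, hI, c, hc, rfl, ?_⟩
  have h := hy _ (point_mem hI)
  rw [sum_inner] at h
  refine (Finset.sum_congr rfl fun i hi => ?_).le.trans h
  rw [inner_smul_left, RCLike.conj_to_real, (inner_dualVertex_eq_iff hp hI hi hI).2 hi, mul_one]

/-- A point of the polar where a functional attains its maximum over the dual vertices is a convex
combination of maximizing dual vertices indexed by a face. -/
lemma exists_convex_combination (hp : p ∈ interior D.polytope) {y z : V} {M : ℝ} (hM : 0 < M)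
    (hy : y ∈ polarAt D.polytope p)
    (hz : ∀ I ∈ D.facets, ∀ i ∈ I, ⟪D.dualVertex p i, z⟫_ℝ ≤ M) (hyz : ⟪y, z⟫_ℝ = M) :
    ∃ I ∈ D.facets, ∃ S ⊆ I, ∃ c : α → ℝ, (∀ i ∈ S, 0 ≤ c i) ∧ ∑ i ∈ S, c i = 1 ∧
      y = ∑ i ∈ S, c i • D.dualVertex p i ∧ ∀ i ∈ S, ⟪D.dualVertex p i, z⟫_ℝ = M := by
  obtain ⟨I, hI, c, hc, rfl, hc1⟩ := exists_sum_le_one hp hy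
  have hle : ∀ i ∈ I, c i * ⟪D.dualVertex p i, z⟫_ℝ ≤ c i * M :=
    fun i hi => mul_le_mul_of_nonneg_left (hz I hI i hi) (hc i hi)
  simp only [sum_inner, inner_smul_left, RCLike.conj_to_real] at hyz
  have h1 := Finset.sum_le_sum hle
  rw [hyz, ← Finset.sum_mul] at h1
  -- Positivity of `M` enters here: a smaller total weight could not reach the value `M`.
  have h2 : ∑ i ∈ I, c i = 1 := le_antisymm hc1 (by
    by_contra hlt
    nlinarith [not_le.1 hlt])
  have h3 := (Finset.sum_eq_sum_iff_of_le hle).1 (by rw [hyz, ← Finset.sum_mul, h2, one_mul])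
  refine ⟨I, hI, I.filter fun i => c i ≠ 0, Finset.filter_subset _ _, c,
    fun i hi => hc i (Finset.mem_filter.1 hi).1, ?_, ?_, fun i hi => ?_⟩
  · rw [← h2]
    exact Finset.sum_filter_of_ne fun i _ hi => hi
  · refine (Finset.sum_filter_of_ne (p := fun i => c i ≠ 0) fun i _ hi h0 => hi ?_).symm
    rw [h0, zero_smul]
  · exact mul_left_cancel₀ (Finset.mem_filter.1 hi).2 (h3 i (Finset.mem_filter.1 hi).1)

variable (D) in
/-- The face of the polar spanned by the dual vertices indexed by `F`. -/
def polarFace (p : V) (F : Finset α) : Set V :=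
  {y | y ∈ polarAt D.polytope p ∧ ∀ I ∈ D.facets, F ⊆ I → ⟪y, D.point I - p⟫_ℝ = 1}

lemma polarFace_subset_iff (hp : p ∈ interior D.polytope) {F G : Finset α} (hF : F ∈ D.faces)
    (hG : G ∈ D.faces) : D.polarFace p F ⊆ D.polarFace p G ↔ F ⊆ G := by
  obtain ⟨I, hI, hFI⟩ := hF
  obtain ⟨I', hI', hGI⟩ := hG
  constructor
  · intro h i hi
    by_contra hiG
    obtain ⟨J, hJ, hGJ, hiJ⟩ := D.exists_notMem I' hI' G hGI i hiG
    have hmem : D.dualVertex p i ∈ D.polarFace p F :=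
      ⟨dualVertex_mem hp hI (hFI hi), fun J hJ hFJ =>
        (inner_dualVertex_eq_iff hp hI (hFI hi) hJ).2 (hFJ hi)⟩
    exact hiJ ((inner_dualVertex_eq_iff hp hI (hFI hi) hJ).1 ((h hmem).2 J hJ hGJ))
  · exact fun h y hy => ⟨hy.1, fun J hJ hGJ => hy.2 J hJ (h.trans hGJ)⟩

/-- The sum of the translated vertices of all facets containing `F` exposes this face: every summand
is at most 1 on the polar, and the bound is attained only when all of them equal 1. -/
lemma isExposed_polarFace (F : Finset α) :
    IsExposed ℝ (polarAt D.polytope p) (D.polarFace p F) := by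
  classical
  rintro ⟨y₀, hy₀⟩
  set T : Finset (Finset α) := (Set.toFinite {I | I ∈ D.facets ∧ F ⊆ I}).toFinset with hT
  have hTmem : ∀ I, I ∈ T ↔ I ∈ D.facets ∧ F ⊆ I := fun I => by simp [hT]
  refine ⟨innerSL ℝ (∑ I ∈ T, (D.point I - p)), ?_⟩
  have key : ∀ y, innerSL ℝ (∑ I ∈ T, (D.point I - p)) y = ∑ I ∈ T, ⟪y, D.point I - p⟫_ℝ := by
    intro y
    rw [innerSL_apply_apply, real_inner_comm, inner_sum]
  have hle : ∀ y ∈ polarAt D.polytope p, ∀ I ∈ T, ⟪y, D.point I - p⟫_ℝ ≤ 1 :=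
    fun y hy I hI => hy _ (point_mem ((hTmem I).1 hI).1)
  have heq : ∀ y ∈ D.polarFace p F, ∑ I ∈ T, ⟪y, D.point I - p⟫_ℝ = ∑ I ∈ T, 1 :=
    fun y hy => Finset.sum_congr rfl fun I hI => hy.2 I ((hTmem I).1 hI).1 ((hTmem I).1 hI).2
  ext y
  constructor
  · refine fun hy => ⟨hy.1, fun z hz => ?_⟩
    rw [key, key, heq y hy]
    exact Finset.sum_le_sum (hle z hz)
  · rintro ⟨hy, hmax⟩
    refine ⟨hy, fun I hI hFI => ?_⟩
    have h := hmax y₀ hy₀.1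
    rw [key, key, heq y₀ hy₀] at h
    exact (Finset.sum_eq_sum_iff_of_le (hle y hy)).1
      (le_antisymm (Finset.sum_le_sum (hle y hy)) h) I ((hTmem I).2 ⟨hI, hFI⟩)

lemma zero_notMem_polarFace {F : Finset α} (hF : F ∈ D.faces) : (0 : V) ∉ D.polarFace p F := by
  obtain ⟨I, hI, h⟩ := hF
  intro h0
  simpa using h0.2 I hI h

/-- Such a point would pair to 1 with all translated vertices, hence to at least 1 with `p - p = 0`.
-/
lemma polarFace_empty (hp : p ∈ interior D.polytope) : D.polarFace p ∅ = ∅ := by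
  refine Set.eq_empty_of_forall_notMem fun y hy => ?_
  have h1 : ∀ I ∈ D.facets, ⟪-y, D.point I⟫_ℝ ≤ -1 - ⟪y, p⟫_ℝ := by
    intro I hI
    have h := hy.2 I hI (by simp)
    rw [inner_sub_right] at h
    rw [inner_neg_left]
    linarith
  have h2 := inner_le_of_forall_point h1 (interior_subset hp)
  rw [inner_neg_left] at h2
  linarith

/-- The face exposed by `z` is indexed by the set `G` of all dual vertices maximal for `z`. The
barycenter of these vertices is also a convex combination of dual vertices of a single facet `I`,
and pairing with the vertex of `I` forces `G ⊆ I`. -/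
lemma exists_polarFace_eq (hp : p ∈ interior D.polytope) {A : Set V}
    (hA : IsExposed ℝ (polarAt D.polytope p) A) (hne : A ≠ polarAt D.polytope p) :
    ∃ F ∈ D.faces, D.polarFace p F = A := by
  classical
  rcases A.eq_empty_or_nonempty with rfl | hAne
  · exact ⟨∅, empty_mem_faces, polarFace_empty hp⟩
  obtain ⟨l, rfl⟩ := hA hAne
  obtain ⟨z, rfl⟩ := (InnerProductSpace.toDual ℝ V).surjective l
  have key : ∀ y, InnerProductSpace.toDual ℝ V z y = ⟪y, z⟫_ℝ := fun y => by
    rw [InnerProductSpace.toDual_apply_apply, real_inner_comm]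
  simp only [key] at hAne hne ⊢
  obtain ⟨a, ha, hamax⟩ := hAne
  have hM0 : 0 < ⟪a, z⟫_ℝ := by
    -- Otherwise all dual vertices pair nonpositively with `z`, which is a nonnegative combination
    -- of some of them. So `z = 0`, and the exposed face is the whole polar.
    by_contra hle
    have hz0 : z = 0 := by
      obtain ⟨I, hI, c, hc, h⟩ := exists_cone_dualVertex hp z
      have h2 : ⟪z, z⟫_ℝ ≤ 0 := by
        have h3 : ⟪z, z⟫_ℝ = ⟪z, ∑ i ∈ I, c i • D.dualVertex p i⟫_ℝ := by rw [← h]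
        rw [h3, inner_sum]
        refine Finset.sum_nonpos fun i hi => ?_
        rw [inner_smul_right, real_inner_comm]
        exact mul_nonpos_of_nonneg_of_nonpos (hc i hi)
          ((hamax _ (dualVertex_mem hp hI hi)).trans (not_lt.1 hle))
      exact real_inner_self_nonpos.1 h2
    refine hne (Set.ext fun y => ⟨fun hy => hy.1, fun hy => ⟨hy, fun y' _ => ?_⟩⟩)
    rw [hz0, inner_zero_right, inner_zero_right]
  set M := ⟪a, z⟫_ℝ
  have hz : ∀ I ∈ D.facets, ∀ i ∈ I, ⟪D.dualVertex p i, z⟫_ℝ ≤ M :=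
    fun I hI i hi => hamax _ (dualVertex_mem hp hI hi)
  set G : Finset α :=
    (Set.toFinite {i | (∃ I ∈ D.facets, i ∈ I) ∧ ⟪D.dualVertex p i, z⟫_ℝ = M}).toFinset with hG
  have hGmem : ∀ i, i ∈ G ↔ (∃ I ∈ D.facets, i ∈ I) ∧ ⟪D.dualVertex p i, z⟫_ℝ = M :=
    fun i => by simp [hG]
  have hmaxG : ∀ y ∈ polarAt D.polytope p, ⟪y, z⟫_ℝ = M → ∃ I ∈ D.facets, ∃ S ⊆ I, S ⊆ G ∧
      ∃ c : α → ℝ, (∀ i ∈ S, 0 ≤ c i) ∧ ∑ i ∈ S, c i = 1 ∧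
      y = ∑ i ∈ S, c i • D.dualVertex p i := by
    intro y hy hyM
    obtain ⟨I, hI, S, hSI, c, hc, hc1, hyc, hSM⟩ := exists_convex_combination hp hM0 hy hz hyM
    exact ⟨I, hI, S, hSI, fun i hi => (hGmem i).2 ⟨⟨I, hI, hSI hi⟩, hSM i hi⟩, c, hc, hc1, hyc⟩
  have hGne : G.Nonempty := by
    obtain ⟨I, hI, S, hSI, hSG, c, hc, hc1, -⟩ := hmaxG a ha rfl
    refine Finset.Nonempty.mono hSG (Finset.nonempty_iff_ne_empty.2 ?_)
    rintro rfl
    simp at hc1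
  have hcard : (0 : ℝ) < G.card := by exact_mod_cast hGne.card_pos
  have hGpolar : ∀ i ∈ G, D.dualVertex p i ∈ polarAt D.polytope p := by
    intro i hi
    obtain ⟨⟨I, hI, hiI⟩, -⟩ := (hGmem i).1 hi
    exact dualVertex_mem hp hI hiI
  have hGface : G ∈ D.faces := by
    have hcsum : ∑ _i ∈ G, (G.card : ℝ)⁻¹ = 1 := by
      rw [Finset.sum_const, nsmul_eq_mul, mul_inv_cancel₀ hcard.ne']
    have hb : ∑ i ∈ G, (G.card : ℝ)⁻¹ • D.dualVertex p i ∈ polarAt D.polytope p :=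
      (convex_polarAt D.polytope).sum_mem (fun i _ => (inv_pos.2 hcard).le) hcsum hGpolar
    obtain ⟨I, hI, S, hSI, -, c, hc, hc1, hbc⟩ := hmaxG _ hb (by
      rw [sum_inner, Finset.sum_congr rfl fun i hi => show _ = (G.card : ℝ)⁻¹ * M by
        rw [inner_smul_left, RCLike.conj_to_real, ((hGmem i).1 hi).2], ← Finset.sum_mul, hcsum,
        one_mul])
    refine ⟨I, hI, fun k hk => ?_⟩
    have h1 : ⟪∑ i ∈ G, (G.card : ℝ)⁻¹ • D.dualVertex p i, D.point I - p⟫_ℝ = 1 := by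
      rw [hbc, sum_inner, ← hc1]
      refine Finset.sum_congr rfl fun i hi => ?_
      rw [inner_smul_left, RCLike.conj_to_real,
        (inner_dualVertex_eq_iff hp hI (hSI hi) hI).2 (hSI hi), mul_one]
    simp only [sum_inner, inner_smul_left, RCLike.conj_to_real] at h1
    have h2 := (Finset.sum_eq_sum_iff_of_le (s := G)
      (f := fun i => (G.card : ℝ)⁻¹ * ⟪D.dualVertex p i, D.point I - p⟫_ℝ)
      (g := fun _ => (G.card : ℝ)⁻¹) (fun i hi => by
        have := hGpolar i hi _ (point_mem hI)
        exact mul_le_of_le_one_right (inv_pos.2 hcard).le this)).1 (by rw [h1, hcsum]) k hk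
    obtain ⟨⟨I', hI', hkI⟩, -⟩ := (hGmem k).1 hk
    rw [← inner_dualVertex_eq_iff hp hI' hkI hI]
    exact mul_left_cancel₀ (inv_pos.2 hcard).ne' (by rw [h2, mul_one])
  refine ⟨G, hGface, ?_⟩
  obtain ⟨J, hJ, hGJ⟩ := hGface
  ext y
  constructor
  · rintro ⟨hy, hyG⟩
    refine ⟨hy, fun y' hy' => ?_⟩
    have hyM : ⟪y, z⟫_ℝ = M := by
      obtain ⟨I, hI, c, hc, rfl, hc1⟩ := exists_sum_le_one hp hy
      have hterm : ∀ J ∈ D.facets, ∀ i ∈ I, c i * ⟪D.dualVertex p i, D.point J - p⟫_ℝ ≤ c i :=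
        fun J hJ i hi => mul_le_of_le_one_right (hc i hi) (inner_dualVertex_le hp hI hi (point_mem hJ))
      have hsum : ∀ J ∈ D.facets, G ⊆ J →
          ∑ i ∈ I, c i * ⟪D.dualVertex p i, D.point J - p⟫_ℝ = 1 := by
        intro J hJ hGJ
        have h := hyG J hJ hGJ
        simpa only [sum_inner, inner_smul_left, RCLike.conj_to_real] using h
      have hc1' : ∑ i ∈ I, c i = 1 :=
        le_antisymm hc1 ((hsum J hJ hGJ).symm.le.trans (Finset.sum_le_sum (hterm J hJ)))
      -- A nonzero coefficient at an index outside `G` would lower the pairing at a facet that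
      -- contains `G` but avoids this index.
      have hsupp : ∀ i ∈ I, c i ≠ 0 → i ∈ G := by
        intro i hi hci
        by_contra hiG
        obtain ⟨J', hJ', hGJ', hiJ'⟩ := D.exists_notMem J hJ G hGJ i hiG
        have h := (Finset.sum_eq_sum_iff_of_le (hterm J' hJ')).1
          (by rw [hsum J' hJ' hGJ', hc1']) i hi
        exact hiJ' ((inner_dualVertex_eq_iff hp hI hi hJ').1
          (mul_left_cancel₀ hci (by rw [h, mul_one])))
      rw [sum_inner, Finset.sum_congr rfl fun i hi => show _ = c i * M from ?_, ← Finset.sum_mul,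
        hc1', one_mul]
      rw [inner_smul_left, RCLike.conj_to_real]
      by_cases hci : c i = 0
      · rw [hci, zero_mul, zero_mul]
      · rw [((hGmem i).1 (hsupp i hi hci)).2]
    rw [hyM]
    exact hamax y' hy'
  · rintro ⟨hy, hymax⟩
    obtain ⟨I, hI, S, hSI, hSG, c, hc, hc1, rfl⟩ :=
      hmaxG y hy (le_antisymm (hamax y hy) (hymax a ha))
    refine ⟨hy, fun J hJ hGJ => ?_⟩
    rw [sum_inner, ← hc1]
    refine Finset.sum_congr rfl fun i hi => ?_
    rw [inner_smul_left, RCLike.conj_to_real,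
      (inner_dualVertex_eq_iff hp hI (hSI hi) hJ).2 (hGJ (hSG hi)), mul_one]

/-- The faces of the complex are the proper faces of the polar. -/
def polarFaceOrderIso (hp : p ∈ interior D.polytope) :
    D.faces ≃o ProperFace (polarAt D.polytope p) :=
  RelIso.ofSurjective
    (OrderEmbedding.ofMapLEIff
      (fun F : D.faces => (⟨D.polarFace p F.1, isExposed_polarFace F.1, fun h =>
        zero_notMem_polarFace F.2 (h ▸ zero_mem_polarAt _)⟩ : ProperFace (polarAt D.polytope p)))
      fun F G => polarFace_subset_iff hp F.2 G.2)
    fun A => by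
      obtain ⟨F, hF, h⟩ := exists_polarFace_eq hp A.2.1 A.2.2
      exact ⟨⟨F, hF⟩, Subtype.ext h⟩

/-- The generator 0 absorbs coefficient sums below 1: such a combination is a center of mass of dual
vertices, shrunk towards 0. -/
lemma isPolytope_polarAt (hp : p ∈ interior D.polytope) : IsPolytope (polarAt D.polytope p) := by
  refine ⟨insert 0 (D.dualVertex p '' {i | ∃ I ∈ D.facets, i ∈ I}),
    ((Set.toFinite _).image _).insert _, Set.Subset.antisymm ?_ fun y hy => ?_⟩
  · refine convexHull_min (Set.insert_subset (zero_mem_polarAt _) ?_) (convex_polarAt _)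
    rintro _ ⟨i, ⟨I, hI, hi⟩, rfl⟩
    exact dualVertex_mem hp hI hi
  · obtain ⟨I, hI, c, hc, rfl, hc1⟩ := exists_sum_le_one hp hy
    have h0 : (0 : V) ∈ convexHull ℝ (insert 0 (D.dualVertex p '' {i | ∃ I ∈ D.facets, i ∈ I})) :=
      subset_convexHull _ _ (Set.mem_insert _ _)
    have hconv := convex_convexHull ℝ (insert 0 (D.dualVertex p '' {i | ∃ I ∈ D.facets, i ∈ I}))
    rcases (Finset.sum_nonneg hc).eq_or_lt with h | h
    · rw [Finset.sum_eq_zero fun i hi => by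
        rw [(Finset.sum_eq_zero_iff_of_nonneg hc).1 h.symm i hi, zero_smul]]
      exact h0
    · have h1 := hconv.starConvex h0 |>.smul_mem (hconv.centerMass_mem hc h fun i hi =>
        subset_convexHull _ _ (Set.mem_insert_of_mem _ ⟨i, ⟨I, hI, hi⟩, rfl⟩))
        h.le hc1
      rwa [Finset.centerMass, smul_smul, mul_inv_cancel₀ h.ne', one_smul] at h1

lemma realizesComplex (hp : p ∈ interior D.polytope) :
    RealizesComplex (polarAt D.polytope p) D.faces :=
  ⟨isPolytope_polarAt hp, ⟨polarFaceOrderIso hp⟩⟩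

end SimplicialFanPolytope

end

noncomputable section

/-! ### Reflections -/

section Reflection

variable {V : Type*} [NormedAddCommGroup V] [InnerProductSpace ℝ V]

lemma reflectionAlong_apply (v x : V) :
    reflectionAlong v x = x - (2 * ⟪v, x⟫_ℝ / ⟪v, v⟫_ℝ) • v := by
  rw [reflectionAlong, Submodule.reflection_orthogonal_apply, Submodule.reflection_singleton_apply,
    real_inner_self_eq_norm_sq, ← Nat.cast_smul_eq_nsmul ℝ 2, smul_smul]
  simp [mul_div_assoc]

lemma reflectionAlong_self (v : V) : reflectionAlong v v = -v := by
  rw [reflectionAlong]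
  exact Submodule.reflection_orthogonalComplement_singleton_eq_neg v

lemma reflectionAlong_smul {c : ℝ} (hc : c ≠ 0) (v : V) :
    reflectionAlong (c • v) = reflectionAlong v := by
  simp only [reflectionAlong, Submodule.span_singleton_smul_eq (IsUnit.mk0 c hc)]

lemma reflectionAlong_mul_self (v : V) : reflectionAlong v * reflectionAlong v = 1 := by
  rw [reflectionAlong]
  exact Submodule.reflection_mul_reflection _

lemma reflectionAlong_map (g : V ≃ₗᵢ[ℝ] V) (v : V) :
    reflectionAlong (g v) = g * reflectionAlong v * g⁻¹ := by
  ext x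
  have h : ⟪g v, x⟫_ℝ = ⟪v, g⁻¹ x⟫_ℝ := by
    rw [← g.inner_map_map v (g⁻¹ x)]
    congr 1
    exact (g.apply_symm_apply x).symm
  have hx : g (g⁻¹ x) = x := g.apply_symm_apply x
  change _ = g (reflectionAlong v (g⁻¹ x))
  rw [reflectionAlong_apply, reflectionAlong_apply, map_sub, map_smul, hx, h, g.inner_map_map]

end Reflection

/-! ### Roots, positive roots and length -/

namespace FiniteCoxeterSystem

variable {ι V : Type*} [NormedAddCommGroup V] [InnerProductSpace ℝ V]
  (C : FiniteCoxeterSystem ι V)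

lemma coe_mul_apply (w w' : C.group) (v : V) :
    ((w * w' : C.group) : V ≃ₗᵢ[ℝ] V) v = (w : V ≃ₗᵢ[ℝ] V) ((w' : V ≃ₗᵢ[ℝ] V) v) := rfl

lemma coe_one_apply (v : V) : ((1 : C.group) : V ≃ₗᵢ[ℝ] V) v = v := rfl

lemma coe_inv_apply_self (w : C.group) (v : V) :
    ((w⁻¹ : C.group) : V ≃ₗᵢ[ℝ] V) ((w : V ≃ₗᵢ[ℝ] V) v) = v := by
  rw [← coe_mul_apply, inv_mul_cancel, coe_one_apply]

lemma coe_apply_inv_self (w : C.group) (v : V) :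
    (w : V ≃ₗᵢ[ℝ] V) (((w⁻¹ : C.group) : V ≃ₗᵢ[ℝ] V) v) = v := by
  rw [← coe_mul_apply, mul_inv_cancel, coe_one_apply]

lemma inner_coe_apply (w : C.group) (x y : V) :
    ⟪(w : V ≃ₗᵢ[ℝ] V) x, y⟫_ℝ = ⟪x, ((w⁻¹ : C.group) : V ≃ₗᵢ[ℝ] V) y⟫_ℝ := by
  conv_lhs => rw [← C.coe_apply_inv_self w y]
  exact (w : V ≃ₗᵢ[ℝ] V).inner_map_map x _

lemma coe_simple (s : ι) : (C.simple s : V ≃ₗᵢ[ℝ] V) = reflectionAlong (C.root s) := rfl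

lemma simple_mul_self (s : ι) : C.simple s * C.simple s = 1 :=
  Subtype.ext (reflectionAlong_mul_self _)

lemma simple_inv (s : ι) : (C.simple s)⁻¹ = C.simple s :=
  inv_eq_of_mul_eq_one_left (C.simple_mul_self s)

lemma simple_apply_root (s : ι) : (C.simple s : V ≃ₗᵢ[ℝ] V) (C.root s) = -C.root s :=
  reflectionAlong_self _

/-- Nonzero vectors orthogonal to a reflecting hyperplane of the group. -/
def IsRoot (v : V) : Prop := v ≠ 0 ∧ reflectionAlong v ∈ C.group

variable {C}

lemma isRoot_root (s : ι) : C.IsRoot (C.root s) := ⟨C.root.ne_zero s, (C.simple s).2⟩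

lemma IsRoot.map {v : V} (hv : C.IsRoot v) (w : C.group) : C.IsRoot ((w : V ≃ₗᵢ[ℝ] V) v) := by
  refine ⟨fun h => hv.1 ((w : V ≃ₗᵢ[ℝ] V).map_eq_zero_iff.1 h), ?_⟩
  rw [reflectionAlong_map]
  exact C.group.mul_mem (C.group.mul_mem w.2 hv.2) (C.group.inv_mem w.2)

lemma IsRoot.smul {v : V} (hv : C.IsRoot v) {c : ℝ} (hc : c ≠ 0) : C.IsRoot (c • v) :=
  ⟨smul_ne_zero hc hv.1, by rw [reflectionAlong_smul hc]; exact hv.2⟩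

/-- A reflection conjugate to a simple one. -/
lemma coe_conj_simple (w : C.group) (s : ι) :
    ((w * C.simple s * w⁻¹ : C.group) : V ≃ₗᵢ[ℝ] V) =
      reflectionAlong ((w : V ≃ₗᵢ[ℝ] V) (C.root s)) := by
  rw [reflectionAlong_map]
  rfl

lemma conj_simple_eq_of_smul {w w' : C.group} {s t : ι} {c : ℝ} (hc : c ≠ 0)
    (h : (w : V ≃ₗᵢ[ℝ] V) (C.root s) = c • (w' : V ≃ₗᵢ[ℝ] V) (C.root t)) :
    w * C.simple s * w⁻¹ = w' * C.simple t * w'⁻¹ :=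
  Subtype.ext (by rw [coe_conj_simple, coe_conj_simple, h, reflectionAlong_smul hc])

/-! ### Pairings with the fundamental weights -/

section Weights

variable [Finite ι] [DecidableEq ι]

lemma inner_root_weight (s t : ι) :
    ⟪C.root s, C.weight t⟫_ℝ = if s = t then ⟪C.root s, C.root s⟫_ℝ / 2 else 0 := by
  have hne : ⟪C.root s, C.root s⟫_ℝ ≠ 0 := inner_self_ne_zero.2 (C.root.ne_zero s)
  have h := LinearMap.BilinForm.apply_dualBasis_left
    (LinearMap.IsRefl.nondegenerate_iff_separatingLeft
      (B := innerₗ V) (fun x y h => by simpa [real_inner_comm] using h) |>.2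
      (fun x hx => inner_self_eq_zero.1 (hx x)))
    (C.root.isUnitSMul (w := fun s => 2 / ⟪C.root s, C.root s⟫_ℝ) fun s =>
      IsUnit.mk0 _ (div_ne_zero two_ne_zero (inner_self_ne_zero.2 (C.root.ne_zero s)))) t s
  change ⟪C.weight t, _⟫_ℝ = _ at h
  rw [Module.Basis.isUnitSMul_apply, inner_smul_right, real_inner_comm (C.root s) (C.weight t)] at h
  split_ifs at h ⊢ with hst
  · field_simp at h ⊢
    linarith
  · exact (mul_eq_zero.1 h).resolve_left (div_ne_zero two_ne_zero hne)

lemma inner_weight (v : V) (t : ι) :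
    ⟪v, C.weight t⟫_ℝ = C.root.repr v t * (⟪C.root t, C.root t⟫_ℝ / 2) := by
  have : Fintype ι := Fintype.ofFinite ι
  conv_lhs => rw [← C.root.sum_repr v, sum_inner]
  simp [-Module.Basis.sum_repr, inner_smul_left, inner_root_weight]

lemma simple_apply_weight {s t : ι} (h : s ≠ t) :
    (C.simple s : V ≃ₗᵢ[ℝ] V) (C.weight t) = C.weight t := by
  rw [coe_simple, reflectionAlong_apply, inner_root_weight, if_neg h]
  simp

end Weights

/-! ### Signs of roots on the chamber -/

lemma exists_chamber_point [Finite ι] (C : FiniteCoxeterSystem ι V) :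
    ∃ x : V, ∀ s, 0 < ⟪C.root s, x⟫_ℝ := by
  classical
  have : Fintype ι := Fintype.ofFinite ι
  refine ⟨∑ t, C.weight t, fun s => ?_⟩
  simp only [inner_sum, inner_root_weight, Finset.sum_ite_eq, Finset.mem_univ, if_true]
  exact half_pos (real_inner_self_pos.2 (C.root.ne_zero s))

variable [Finite ι]

variable (C) in
/-- A point of the fundamental chamber. -/
def chamberPoint : V := C.exists_chamber_point.choose

lemma inner_root_chamberPoint (s : ι) : 0 < ⟪C.root s, C.chamberPoint⟫_ℝ :=
  C.exists_chamber_point.choose_spec s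

variable (C) in
/-- The height of a vector. A root is positive if and only if its height is positive. -/
def height (v : V) : ℝ := ⟪v, C.chamberPoint⟫_ℝ

lemma height_root (s : ι) : 0 < C.height (C.root s) := inner_root_chamberPoint s

lemma height_smul (c : ℝ) (v : V) : C.height (c • v) = c * C.height v := by
  simp [height, inner_smul_left]

lemma height_neg (v : V) : C.height (-v) = -C.height v := by
  simp [height]

lemma IsRoot.inner_ne_zero {v : V} (hv : C.IsRoot v) {x : V} (hx : ∀ s, 0 < ⟪C.root s, x⟫_ℝ) :
    ⟪v, x⟫_ℝ ≠ 0 := by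
  intro h
  refine C.chamber v hv.1 hv.2 x hx ?_
  rw [reflectionAlong_apply, h]
  simp

lemma IsRoot.height_ne_zero {v : V} (hv : C.IsRoot v) : C.height v ≠ 0 :=
  hv.inner_ne_zero inner_root_chamberPoint

/-- A change of sign between two points of the chamber would make some positive combination of them
orthogonal to the root, and the chamber is a convex cone. -/
lemma IsRoot.inner_pos {v : V} (hv : C.IsRoot v) (h : 0 < C.height v) {x : V}
    (hx : ∀ s, 0 < ⟪C.root s, x⟫_ℝ) : 0 < ⟪v, x⟫_ℝ := by
  by_contra hle
  have hlt : ⟪v, x⟫_ℝ < 0 := (not_lt.1 hle).lt_of_ne (hv.inner_ne_zero hx)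
  refine hv.inner_ne_zero (x := C.height v • x - ⟪v, x⟫_ℝ • C.chamberPoint) (fun s => ?_) ?_
  · rw [inner_sub_right, inner_smul_right, inner_smul_right]
    nlinarith [mul_pos h (hx s), mul_pos (neg_pos.2 hlt) (inner_root_chamberPoint (C := C) s)]
  · rw [inner_sub_right, inner_smul_right, inner_smul_right, height]
    ring

/-- Weights lie in the closed chamber. Were the pairing negative, adding the right multiple of the
chamber point would give a point of the open chamber orthogonal to `v`. -/
lemma IsRoot.inner_weight_nonneg [DecidableEq ι] {v : V} (hv : C.IsRoot v) (h : 0 < C.height v)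
    (t : ι) : 0 ≤ ⟪v, C.weight t⟫_ℝ := by
  by_contra hlt
  rw [not_le] at hlt
  have h1 := hv.inner_pos h (x := C.weight t + (-⟪v, C.weight t⟫_ℝ / C.height v) • C.chamberPoint)
    (fun s => by
      rw [inner_add_right, inner_smul_right, inner_root_weight]
      have h2 := mul_pos (div_pos (neg_pos.2 hlt) h) (inner_root_chamberPoint (C := C) s)
      have h3 := real_inner_self_nonneg (x := C.root s)
      split_ifs <;> linarith)
  rw [inner_add_right, inner_smul_right, ← height, div_mul_cancel₀ _ h.ne'] at h1
  linarith

/-- A simple reflection permutes the positive roots that are not multiples of its simple root. -/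
lemma IsRoot.eq_smul_root {v : V} (hv : C.IsRoot v) (h : 0 < C.height v) {s : ι}
    (hs : C.height ((C.simple s : V ≃ₗᵢ[ℝ] V) v) < 0) : ∃ c : ℝ, 0 < c ∧ v = c • C.root s := by
  classical
  -- The reflection `s` fixes the weight of `t`, so the positive roots `v` and `-s v` have opposite
  -- nonnegative pairings with it.
  have h0 : ∀ t, t ≠ s → C.root.repr v t = 0 := by
    intro t hts
    have h1 := hv.inner_weight_nonneg h t
    have h2 := ((hv.map (C.simple s)).smul (c := -1) (by norm_num)).inner_weight_nonneg
      (by rw [height_smul]; linarith) t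
    rw [inner_smul_left, inner_coe_apply, simple_inv, simple_apply_weight hts.symm,
      RCLike.conj_to_real] at h2
    have h3 : ⟪v, C.weight t⟫_ℝ = 0 := by linarith
    rw [inner_weight] at h3
    refine (mul_eq_zero.1 h3).resolve_right ?_
    exact (half_pos (real_inner_self_pos.2 (C.root.ne_zero t))).ne'
  have h1 : v = C.root.repr v s • C.root s := by
    refine C.root.ext_elem fun t => ?_
    by_cases hts : t = s
    · subst hts; simp
    · rw [h0 t hts]; simp [Ne.symm hts]
  refine ⟨_, ?_, h1⟩
  rw [h1, height_smul] at h
  exact pos_of_mul_pos_left h (height_root s).le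

/-! ### Words, the exchange condition and the longest element -/

lemma wordProd_cons (s : ι) (l : List ι) : C.wordProd (s :: l) = C.simple s * C.wordProd l := by
  simp [wordProd]

lemma wordProd_append (l l' : List ι) : C.wordProd (l ++ l') = C.wordProd l * C.wordProd l' := by
  simp [wordProd]

lemma exists_wordProd_eq (w : C.group) : ∃ l, C.wordProd l = w := by
  obtain ⟨w, hw⟩ := w
  induction hw using Subgroup.closure_induction with
  | mem x hx =>
    obtain ⟨s, rfl⟩ := hx
    exact ⟨[s], by simp [wordProd]; rfl⟩
  | one => exact ⟨[], rfl⟩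
  | mul x y hx hy h1 h2 =>
    obtain ⟨l, h1⟩ := h1
    obtain ⟨l', h2⟩ := h2
    exact ⟨l ++ l', by rw [wordProd_append, h1, h2]; rfl⟩
  | inv x hx h =>
    obtain ⟨l, h⟩ := h
    have hrev : ∀ l : List ι, C.wordProd l.reverse = (C.wordProd l)⁻¹ := by
      intro l
      induction l with
      | nil => simp [wordProd]
      | cons s l ih =>
        rw [List.reverse_cons, wordProd_append, ih, wordProd_cons s l, mul_inv_rev, simple_inv]
        simp [wordProd]
    exact ⟨l.reverse, by rw [hrev, h]; rfl⟩

lemma length_wordProd_le (l : List ι) : C.length (C.wordProd l) ≤ l.length :=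
  Nat.sInf_le ⟨l, rfl, rfl⟩

lemma exists_word (w : C.group) : ∃ l, l.length = C.length w ∧ C.wordProd l = w := by
  obtain ⟨l, hl⟩ := exists_wordProd_eq w
  exact Nat.sInf_mem (s := {n | ∃ l : List ι, l.length = n ∧ C.wordProd l = w}) ⟨_, l, rfl, hl⟩

lemma length_one : C.length 1 = 0 := Nat.le_zero.1 (length_wordProd_le (C := C) [])

lemma length_mul_simple_le (w : C.group) (s : ι) :
    C.length (w * C.simple s) ≤ C.length w + 1 := by
  obtain ⟨l, hl, rfl⟩ := exists_word w
  have h := length_wordProd_le (C := C) (l ++ [s])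
  rw [wordProd_append, List.length_append, hl] at h
  simpa [wordProd] using h

/-- The exchange condition. -/
lemma exists_word_mul_simple (l : List ι) (s : ι)
    (h : C.height ((C.wordProd l : V ≃ₗᵢ[ℝ] V) (C.root s)) < 0) :
    ∃ l', l'.length + 1 = l.length ∧ C.wordProd l' = C.wordProd l * C.simple s := by
  induction l with
  | nil => exact absurd h (height_root s).not_gt
  | cons t l ih =>
    have hroot : C.IsRoot ((C.wordProd l : V ≃ₗᵢ[ℝ] V) (C.root s)) := (isRoot_root s).map _
    rcases hroot.height_ne_zero.lt_or_gt with hneg | hpos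
    · obtain ⟨l', h1, h2⟩ := ih hneg
      exact ⟨t :: l', by simpa using h1, by rw [wordProd_cons, h2, wordProd_cons, mul_assoc]⟩
    -- The letter `t` turns a positive root negative, so this root is proportional to the simple
    -- root of `t` and has the same reflection: the letter `t` is the one to delete.
    · rw [wordProd_cons, coe_mul_apply] at h
      obtain ⟨c, hc, h1⟩ := hroot.eq_smul_root hpos h
      have h2 := conj_simple_eq_of_smul (w' := 1) hc.ne' h1
      refine ⟨l, rfl, ?_⟩
      rw [one_mul, inv_one, mul_one, mul_inv_eq_iff_eq_mul] at h2
      rw [wordProd_cons, mul_assoc, h2, ← mul_assoc, simple_mul_self, one_mul]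

lemma length_mul_simple_lt {w : C.group} {s : ι}
    (h : C.height ((w : V ≃ₗᵢ[ℝ] V) (C.root s)) < 0) : C.length (w * C.simple s) < C.length w := by
  obtain ⟨l, hl, rfl⟩ := exists_word w
  obtain ⟨l', h1, h2⟩ := exists_word_mul_simple l s h
  have h3 := length_wordProd_le (C := C) l'
  rw [h2] at h3
  omega

lemma lt_length_mul_simple {w : C.group} {s : ι}
    (h : 0 < C.height ((w : V ≃ₗᵢ[ℝ] V) (C.root s))) :
    C.length w < C.length (w * C.simple s) := by
  have h1 := length_mul_simple_lt (w := w * C.simple s) (s := s)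
    (by rw [coe_mul_apply, simple_apply_root, map_neg, height_neg]; linarith)
  rwa [mul_assoc, simple_mul_self, mul_one] at h1

lemma length_le_longest (w : C.group) : C.length w ≤ C.length C.longest :=
  Classical.choose_spec (Finite.exists_max C.length) w

/-- A positive image would make the product of the longest element with `s` longer still. -/
lemma height_longest_root (s : ι) : C.height ((C.longest : V ≃ₗᵢ[ℝ] V) (C.root s)) < 0 := by
  refine ((isRoot_root s).map C.longest).height_ne_zero.lt_or_gt.resolve_right fun h => ?_
  exact (lt_length_mul_simple h).not_ge (length_le_longest _)

lemma IsRoot.height_longest {v : V} (hv : C.IsRoot v) (h : 0 < C.height v) :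
    C.height ((C.longest : V ≃ₗᵢ[ℝ] V) v) < 0 := by
  classical
  have : Fintype ι := Fintype.ofFinite ι
  refine lt_of_le_of_ne ?_ (hv.map C.longest).height_ne_zero
  conv_lhs => rw [← C.root.sum_repr v]
  rw [map_sum, height, sum_inner]
  refine Finset.sum_nonpos fun t _ => ?_
  rw [map_smul, inner_smul_left, RCLike.conj_to_real]
  refine mul_nonpos_of_nonneg_of_nonpos ?_ (height_longest_root t).le
  have h1 := hv.inner_weight_nonneg h t
  rw [inner_weight] at h1
  exact nonneg_of_mul_nonneg_left h1 (half_pos (real_inner_self_pos.2 (C.root.ne_zero t)))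

lemma IsRoot.height_longest_inv {v : V} (hv : C.IsRoot v) (h : 0 < C.height v) :
    C.height (((C.longest⁻¹ : C.group) : V ≃ₗᵢ[ℝ] V) v) < 0 := by
  refine (hv.map _).height_ne_zero.lt_or_gt.resolve_right fun h1 => ?_
  have h2 := (hv.map _).height_longest h1
  rw [coe_apply_inv_self] at h2
  exact h2.not_gt h

end FiniteCoxeterSystem

end

noncomputable section

/-! ### Facets and their prefix products -/

namespace FiniteCoxeterSystem

variable {ι V : Type*} [NormedAddCommGroup V] [InnerProductSpace ℝ V]
  [Finite ι] {C : FiniteCoxeterSystem ι V} {Q : List ι}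

lemma length_subword (P : Finset (Fin Q.length)) : (subword Q P).length = P.card := by
  rw [subword, List.length_map, ← List.toFinset_card_of_nodup ((List.nodup_finRange _).filter _)]
  congr 1
  ext k
  simp

variable (C Q) in
/-- The contribution of a position to the products over the complement of `I`. -/
def letterOutside (I : Finset (Fin Q.length)) (z : Fin Q.length) : C.group :=
  if z ∈ I then 1 else C.simple (Q.get z)

variable (C Q) in
/-- The product of the letters at the first `k` positions which do not belong to `I`. -/
def takeProd (I : Finset (Fin Q.length)) (k : ℕ) : C.group :=
  (((List.finRange Q.length).take k).map (C.letterOutside Q I)).prod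

lemma takeProd_zero (I : Finset (Fin Q.length)) : C.takeProd Q I 0 = 1 := by simp [takeProd]

lemma take_finRange_succ {n : ℕ} (k : Fin n) :
    (List.finRange n).take (k + 1) = (List.finRange n).take k ++ [k] := by
  rw [List.take_succ_eq_append_getElem (by simp)]
  simp

lemma takeProd_succ (I : Finset (Fin Q.length)) (k : Fin Q.length) :
    C.takeProd Q I (k + 1) = C.takeProd Q I k * C.letterOutside Q I k := by
  rw [takeProd, take_finRange_succ, List.map_append, List.prod_append]
  simp [takeProd]

lemma takeProd_succ_of_mem {I : Finset (Fin Q.length)} {k : Fin Q.length} (h : k ∈ I) :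
    C.takeProd Q I (k + 1) = C.takeProd Q I k := by
  rw [takeProd_succ, letterOutside, if_pos h, mul_one]

lemma takeProd_succ_of_notMem {I : Finset (Fin Q.length)} {k : Fin Q.length} (h : k ∉ I) :
    C.takeProd Q I (k + 1) = C.takeProd Q I k * C.simple (Q.get k) := by
  rw [takeProd_succ, letterOutside, if_neg h]

lemma prod_map_letterOutside (I : Finset (Fin Q.length)) (l : List (Fin Q.length)) :
    (l.map (C.letterOutside Q I)).prod = C.wordProd ((l.filter (fun z => z ∉ I)).map Q.get) := by
  induction l with
  | nil => rfl
  | cons z l ih =>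
    rw [List.map_cons, List.prod_cons, ih, letterOutside, List.filter_cons]
    split_ifs with h1 h2 h2
    · simp [h1] at h2
    · rw [one_mul]
    · rw [List.map_cons, wordProd_cons]
    · simp [h1] at h2

lemma wordProd_subword_compl (I : Finset (Fin Q.length)) :
    C.wordProd (subword Q Iᶜ) = C.takeProd Q I Q.length := by
  rw [takeProd, prod_map_letterOutside, List.take_of_length_le (by simp), subword]
  simp

lemma prefixProd_eq (I : Finset (Fin Q.length)) (k : Fin Q.length) :
    C.prefixProd Q I k = C.takeProd Q I k := by
  rw [takeProd, prod_map_letterOutside, prefixProd, subword]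
  congr 2
  conv_lhs => rw [← List.take_append_drop k (List.finRange Q.length), List.filter_append]
  have hdrop : ((List.finRange Q.length).drop k).filter
      (fun z => z ∈ Finset.univ.filter fun z => z < k ∧ z ∉ I) = [] := by
    rw [List.filter_eq_nil_iff]
    intro z hz
    obtain ⟨n, hn, rfl⟩ := List.mem_iff_getElem.1 hz
    intro h
    have h1 := (Finset.mem_filter.1 (of_decide_eq_true h)).2.1
    simp only [List.getElem_drop, List.getElem_finRange, Fin.lt_def, Fin.val_cast] at h1
    omega
  rw [hdrop, List.append_nil]
  refine List.filter_congr fun z hz => ?_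
  obtain ⟨n, hn, rfl⟩ := List.mem_iff_getElem.1 hz
  have hn' : n < k := by
    rw [List.length_take] at hn
    omega
  simp only [List.getElem_take, List.getElem_finRange]
  have hlt : (⟨n, hn'.trans k.2⟩ : Fin Q.length) < k := hn'
  simp [hlt]

lemma rootFunction_eq (I : Finset (Fin Q.length)) (k : Fin Q.length) :
    C.rootFunction Q I k = (C.takeProd Q I k : V ≃ₗᵢ[ℝ] V) (C.root (Q.get k)) := by
  rw [rootFunction, prefixProd_eq]

lemma weightFunction_eq [DecidableEq ι] (I : Finset (Fin Q.length)) (k : Fin Q.length) :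
    C.weightFunction Q I k = (C.takeProd Q I k : V ≃ₗᵢ[ℝ] V) (C.weight (Q.get k)) := by
  rw [weightFunction, prefixProd_eq]

lemma isRoot_rootFunction (I : Finset (Fin Q.length)) (k : Fin Q.length) :
    C.IsRoot (C.rootFunction Q I k) := by
  rw [rootFunction_eq]
  exact (isRoot_root _).map _

lemma takeProd_inv_rootFunction (I : Finset (Fin Q.length)) (k : Fin Q.length) :
    (((C.takeProd Q I k)⁻¹ : C.group) : V ≃ₗᵢ[ℝ] V) (C.rootFunction Q I k) = C.root (Q.get k) := by
  rw [rootFunction_eq, coe_inv_apply_self]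

/-! ### Facets as complements of reduced words of the longest element -/

lemma isFacet_iff {I : Finset (Fin Q.length)} :
    C.IsFacet Q I ↔ Iᶜ.card = C.length C.longest ∧ C.takeProd Q I Q.length = C.longest := by
  rw [← wordProd_subword_compl]
  constructor
  · intro h
    obtain ⟨P, hP, hred, hprod⟩ := h.prop
    -- The complement of the reduced subword is a face containing `I`, hence equal to `I` by
    -- maximality.
    have h1 : Pᶜ ∈ C.sphericalSubwordComplex Q := ⟨P, by simp, hred, hprod⟩
    have h2 : I ⊆ Pᶜ := by rwa [Finset.subset_compl_comm]
    have h3 : I = Pᶜ := Finset.Subset.antisymm h2 (h.le_of_ge h1 h2)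
    have h4 : Iᶜ = P := by rw [h3, compl_compl]
    rw [h4]
    refine ⟨?_, hprod⟩
    rw [← length_subword, ← hprod]
    exact hred
  · rintro ⟨hcard, hprod⟩
    refine ⟨⟨Iᶜ, subset_rfl, ?_, hprod⟩, ?_⟩
    · rw [IsReduced, length_subword, hcard, hprod]
    · rintro F ⟨P, hP, hred, hPprod⟩ hIF
      rw [IsReduced, length_subword, hPprod, ← hcard] at hred
      have h1 : P ⊆ Iᶜ := hP.trans (Finset.compl_subset_compl.2 hIF)
      have h2 : P = Iᶜ := Finset.eq_of_subset_of_card_le h1 hred.ge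
      rw [h2] at hP
      exact Finset.compl_subset_compl.1 hP

lemma exists_isFacet_of_mem {F : Finset (Fin Q.length)} (hF : F ∈ C.sphericalSubwordComplex Q) :
    ∃ I, C.IsFacet Q I ∧ F ⊆ I := by
  obtain ⟨I, hFI, hI⟩ := (Set.toFinite (C.sphericalSubwordComplex Q)).exists_le_maximal hF
  exact ⟨I, hI, hFI⟩

lemma mem_sphericalSubwordComplex_iff {F : Finset (Fin Q.length)} :
    F ∈ C.sphericalSubwordComplex Q ↔ ∃ I, C.IsFacet Q I ∧ F ⊆ I := by
  refine ⟨exists_isFacet_of_mem, ?_⟩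
  rintro ⟨I, hI, hFI⟩
  obtain ⟨P, hP, h⟩ := hI.prop
  exact ⟨P, hP.trans (Finset.compl_subset_compl.2 hFI), h⟩

/-- Each letter raises the length by at most one; the form is additive to avoid subtraction. When
the total number of letters is the length of the product, no letter can lower the length. -/
lemma length_takeProd_add (I : Finset (Fin Q.length)) {j k : ℕ} (hjk : j ≤ k)
    (hk : k ≤ Q.length) :
    C.length (C.takeProd Q I k) + ((List.finRange Q.length).take j).countP (fun z => z ∉ I) ≤
      C.length (C.takeProd Q I j) +
        ((List.finRange Q.length).take k).countP (fun z => z ∉ I) := by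
  induction k, hjk using Nat.le_induction with
  | base => exact le_rfl
  | succ k hjk ih =>
    have h := ih (by omega)
    have h1 := takeProd_succ (C := C) I ⟨k, hk⟩
    have h2 := take_finRange_succ (⟨k, hk⟩ : Fin Q.length)
    simp only at h1 h2
    rw [h1, h2, List.countP_append]
    by_cases hkI : (⟨k, hk⟩ : Fin Q.length) ∈ I
    · rw [letterOutside, if_pos hkI, mul_one]
      omega
    · rw [letterOutside, if_neg hkI]
      have h3 := length_mul_simple_le (C.takeProd Q I k) (Q.get ⟨k, hk⟩)
      have h4 : List.countP (fun z => decide (z ∉ I)) [(⟨k, hk⟩ : Fin Q.length)] = 1 := by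
        simp [hkI]
      omega

/-- The roots of a facet at the positions of its complement are positive. -/
lemma IsFacet.height_pos {I : Finset (Fin Q.length)} (hI : C.IsFacet Q I) {k : Fin Q.length}
    (hk : k ∉ I) : 0 < C.height (C.rootFunction Q I k) := by
  refine (isRoot_rootFunction I k).height_ne_zero.lt_or_gt.resolve_left fun hneg => ?_
  rw [rootFunction_eq] at hneg
  have h1 := length_mul_simple_lt hneg
  rw [← takeProd_succ_of_notMem hk] at h1
  have h2 := length_takeProd_add (C := C) I (Nat.zero_le k) k.2.le
  have h3 := length_takeProd_add (C := C) I (Nat.succ_le_of_lt k.2) le_rfl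
  rw [(isFacet_iff.1 hI).2, ← (isFacet_iff.1 hI).1] at h3
  have h4 : ((List.finRange Q.length).take Q.length).countP (fun z => z ∉ I) = Iᶜ.card := by
    rw [List.take_of_length_le (by simp), ← length_subword, subword, List.length_map,
      List.countP_eq_length_filter]
    simp
  rw [h4, Nat.succ_eq_add_one, take_finRange_succ, List.countP_append] at h3
  have h5 : List.countP (fun z => decide (z ∉ I)) [k] = 1 := by
    simp [hk]
  rw [takeProd_zero, length_one] at h2
  simp only [List.take_zero, List.countP_nil] at h2
  omega

/-- If the sign of a root changes at a position, then it is proportional to the root there. -/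
lemma eq_smul_rootFunction {I : Finset (Fin Q.length)} {v : V} (hv : C.IsRoot v)
    {k : Fin Q.length}
    (h : 0 < C.height ((((C.takeProd Q I k)⁻¹ : C.group) : V ≃ₗᵢ[ℝ] V) v))
    (h' : C.height ((((C.takeProd Q I (k + 1))⁻¹ : C.group) : V ≃ₗᵢ[ℝ] V) v) < 0) :
    k ∉ I ∧ ∃ c : ℝ, 0 < c ∧ v = c • C.rootFunction Q I k := by
  have hk : k ∉ I := by
    intro hk
    rw [takeProd_succ_of_mem hk] at h'
    exact h'.not_gt h
  rw [takeProd_succ_of_notMem hk, mul_inv_rev, simple_inv, coe_mul_apply] at h'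
  obtain ⟨c, hc, hc'⟩ := (hv.map _).eq_smul_root h h'
  refine ⟨hk, c, hc, ?_⟩
  rw [rootFunction_eq, ← map_smul, ← hc', coe_apply_inv_self]

/-- If the sign became positive again, `-v` would be a positive multiple of a root outside `I`, and
these roots are positive. -/
lemma IsFacet.height_neg_of_le {I : Finset (Fin Q.length)} (hI : C.IsFacet Q I) {v : V}
    (hv : C.IsRoot v) (hpos : 0 < C.height v) {j k : ℕ} (hjk : j ≤ k) (hk : k ≤ Q.length)
    (h : C.height ((((C.takeProd Q I j)⁻¹ : C.group) : V ≃ₗᵢ[ℝ] V) v) < 0) :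
    C.height ((((C.takeProd Q I k)⁻¹ : C.group) : V ≃ₗᵢ[ℝ] V) v) < 0 := by
  induction k, hjk using Nat.le_induction with
  | base => exact h
  | succ k hjk ih =>
    have h1 := ih (by omega)
    refine (hv.map _).height_ne_zero.lt_or_gt.resolve_right fun h2 => ?_
    have hv' : C.IsRoot (-v) := by simpa using hv.smul (c := -1) (by norm_num)
    obtain ⟨hkI, c, hc, hc'⟩ := eq_smul_rootFunction (I := I) hv' (k := ⟨k, hk⟩)
      (by rw [map_neg, height_neg]; exact neg_pos.2 h1)
      (by rw [map_neg, height_neg]; exact neg_neg_of_pos h2)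
    have h3 := congrArg C.height hc'
    rw [height_neg, height_smul] at h3
    have h4 := mul_pos hc (hI.height_pos hkI)
    linarith

/-- Every positive root occurs, up to a positive factor, in the complement of a facet. -/
lemma IsFacet.exists_eq_smul {I : Finset (Fin Q.length)} (hI : C.IsFacet Q I) {v : V}
    (hv : C.IsRoot v) (hpos : 0 < C.height v) :
    ∃ j ∉ I, ∃ c : ℝ, 0 < c ∧ v = c • C.rootFunction Q I j := by
  by_contra hcon
  have h : ∀ k ≤ Q.length, 0 < C.height ((((C.takeProd Q I k)⁻¹ : C.group) : V ≃ₗᵢ[ℝ] V) v) := by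
    intro k
    induction k with
    | zero => intro _; rw [takeProd_zero, inv_one, coe_one_apply]; exact hpos
    | succ k ih =>
      intro hk
      refine (hv.map _).height_ne_zero.lt_or_gt.resolve_left fun h2 => hcon ?_
      exact ⟨⟨k, hk⟩, eq_smul_rootFunction hv (k := ⟨k, hk⟩) (ih (by omega)) h2⟩
  have h1 := h _ le_rfl
  rw [(isFacet_iff.1 hI).2] at h1
  exact (hv.height_longest_inv hpos).not_gt h1

/-- The root at `j` is pulled back to a simple root just before the letter `j` and to its negative
just after. As signs never return to positive, `j` is the only moment of change. -/
lemma IsFacet.height_takeProd_inv_pos_iff {I : Finset (Fin Q.length)} (hI : C.IsFacet Q I)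
    {j : Fin Q.length} (hj : j ∉ I) {k : ℕ} (hk : k ≤ Q.length) :
    0 < C.height ((((C.takeProd Q I k)⁻¹ : C.group) : V ≃ₗᵢ[ℝ] V) (C.rootFunction Q I j)) ↔
      k ≤ j := by
  have hroot := isRoot_rootFunction (C := C) I j
  have hpos := hI.height_pos hj
  constructor
  · intro h
    by_contra hjk
    refine h.not_gt (hI.height_neg_of_le hroot hpos (Nat.succ_le_of_lt (not_le.1 hjk)) hk ?_)
    rw [Nat.succ_eq_add_one, takeProd_succ_of_notMem hj, mul_inv_rev, coe_mul_apply, simple_inv,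
      takeProd_inv_rootFunction, simple_apply_root, C.height_neg]
    exact neg_neg_of_pos (height_root _)
  · intro h
    refine (hroot.map _).height_ne_zero.lt_or_gt.resolve_left fun h2 => ?_
    have h3 := hI.height_neg_of_le hroot hpos h j.2.le h2
    rw [takeProd_inv_rootFunction] at h3
    exact h3.not_gt (height_root _)

/-- Proportional positive roots change sign at the same moment, and this moment is the position. -/
lemma IsFacet.eq_of_smul {I : Finset (Fin Q.length)} (hI : C.IsFacet Q I) {j k : Fin Q.length}
    (hj : j ∉ I) (hk : k ∉ I) {c : ℝ} (h : C.rootFunction Q I j = c • C.rootFunction Q I k) :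
    j = k := by
  have hc : 0 < c := by
    have h1 := hI.height_pos hj
    rw [h, height_smul] at h1
    exact pos_of_mul_pos_left h1 (hI.height_pos hk).le
  have key : ∀ n ≤ Q.length, n ≤ j ↔ n ≤ k := by
    intro n hn
    rw [← hI.height_takeProd_inv_pos_iff hj hn, ← hI.height_takeProd_inv_pos_iff hk hn, h,
      map_smul, height_smul, mul_pos_iff_of_pos_left hc]
  have h1 := (key j j.2.le).1 le_rfl
  have h2 := (key k k.2.le).2 le_rfl
  exact Fin.ext (le_antisymm h1 h2)

end FiniteCoxeterSystem

end

noncomputable section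

/-! ### Flips -/

namespace FiniteCoxeterSystem

variable {ι V : Type*} [NormedAddCommGroup V] [InnerProductSpace ℝ V]
  [Finite ι] [DecidableEq ι] {C : FiniteCoxeterSystem ι V} {Q : List ι}

/-- The facet `J` is obtained from the facet `I` by flipping the position `i` to the position `j`. -/
structure IsFlip (C : FiniteCoxeterSystem ι V) (Q : List ι) (I : Finset (Fin Q.length))
    (i : Fin Q.length) (J : Finset (Fin Q.length)) (j : Fin Q.length) : Prop where
  mem : i ∈ I
  notMem : j ∉ I
  eq_insert : J = insert j (I.erase i)
  facet_left : C.IsFacet Q I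
  facet_right : C.IsFacet Q J
  root_new : ∃ c : ℝ, 0 < c ∧ C.rootFunction Q J j = -(c • C.rootFunction Q I i)
  root_eq_or : ∀ k, C.rootFunction Q J k = C.rootFunction Q I k ∨
    C.rootFunction Q J k = reflectionAlong (C.rootFunction Q I i) (C.rootFunction Q I k)
  brick : ∃ d : ℝ, 0 < d ∧ C.brickVector Q I - C.brickVector Q J = d • C.rootFunction Q I i
  lt_of_height_neg : C.height (C.rootFunction Q I i) < 0 → j < i

/-- Exchanging two positions with proportional roots multiplies the prefix products between them by
the reflection along these roots. -/
lemma takeProd_exchange {I : Finset (Fin Q.length)} {i j : Fin Q.length} (hi : i ∈ I) (hj : j ∉ I)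
    {c : ℝ} (hc : c ≠ 0) (h : C.rootFunction Q I j = c • C.rootFunction Q I i) :
    ∃ t : C.group, (t : V ≃ₗᵢ[ℝ] V) = reflectionAlong (C.rootFunction Q I i) ∧
      ∀ k ≤ Q.length, C.takeProd Q (insert j (I.erase i)) k =
        if min i.1 j.1 < k ∧ k ≤ max i.1 j.1 then t * C.takeProd Q I k else C.takeProd Q I k := by
  have hij : i ≠ j := fun hij => hj (hij ▸ hi)
  have hij' : i.1 ≠ j.1 := fun h => hij (Fin.ext h)
  set t : C.group := C.takeProd Q I i * C.simple (Q.get i) * (C.takeProd Q I i)⁻¹ with ht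
  have htj : t = C.takeProd Q I j * C.simple (Q.get j) * (C.takeProd Q I j)⁻¹ := by
    rw [rootFunction_eq, rootFunction_eq] at h
    exact (conj_simple_eq_of_smul hc h).symm
  have htt : t * t = 1 := by
    rw [ht]
    simp only [mul_assoc, inv_mul_cancel_left]
    rw [← mul_assoc (C.simple _) (C.simple _), simple_mul_self]
    simp
  refine ⟨t, by rw [ht, coe_conj_simple, rootFunction_eq], ?_⟩
  -- Inserting the letter at `i` or deleting the one at `j` multiplies all later prefixes on the
  -- left by `t`; beyond both positions the two factors cancel.
  have key : ∀ k ≤ Q.length, C.takeProd Q (insert j (I.erase i)) k =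
      (if i.1 < k then t else 1) * ((if j.1 < k then t else 1) * C.takeProd Q I k) := by
    intro k
    induction k with
    | zero => intro _; simp [takeProd_zero]
    | succ k ih =>
      intro hk
      have h1 := takeProd_succ (C := C) (insert j (I.erase i)) ⟨k, hk⟩
      have h2 := takeProd_succ (C := C) I ⟨k, hk⟩
      simp only at h1 h2
      rw [h1, ih (by omega), h2]
      rcases eq_or_ne k i.1 with rfl | hki
      · have e1 : C.letterOutside Q (insert j (I.erase i)) i = C.simple (Q.get i) := by
          rw [letterOutside, if_neg]
          simp [hij]
        have e2 : C.letterOutside Q I i = 1 := by rw [letterOutside, if_pos hi]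
        have e3 : t * C.takeProd Q I i = C.takeProd Q I i * C.simple (Q.get i) := by
          rw [ht, inv_mul_cancel_right]
        have e4 : (j.1 < i.1 + 1) ↔ (j.1 < i.1) := by omega
        simp only [Fin.eta, e1, e2, e4, lt_irrefl, if_false, lt_add_one, if_true, one_mul, mul_one]
        split_ifs
        · rw [mul_assoc, ← e3]
        · rw [one_mul, e3]
      rcases eq_or_ne k j.1 with rfl | hkj
      · have e1 : C.letterOutside Q (insert j (I.erase i)) j = 1 := by
          rw [letterOutside, if_pos]
          simp
        have e2 : C.letterOutside Q I j = C.simple (Q.get j) := by rw [letterOutside, if_neg hj]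
        have e3 : C.takeProd Q I j * C.simple (Q.get j) = t * C.takeProd Q I j := by
          rw [htj, inv_mul_cancel_right]
        have e4 : (i.1 < j.1 + 1) ↔ (i.1 < j.1) := by omega
        simp only [Fin.eta, e1, e2, e4, lt_irrefl, if_false, lt_add_one, if_true, one_mul, mul_one]
        rw [e3, ← mul_assoc t t, htt, one_mul]
      · have e1 : C.letterOutside Q (insert j (I.erase i)) ⟨k, hk⟩ =
            C.letterOutside Q I ⟨k, hk⟩ := by
          have h3 : (⟨k, hk⟩ : Fin Q.length) ≠ i := fun h => hki (congrArg Fin.val h)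
          have h4 : (⟨k, hk⟩ : Fin Q.length) ≠ j := fun h => hkj (congrArg Fin.val h)
          simp only [letterOutside, Finset.mem_insert, Finset.mem_erase, h3, h4, ne_eq,
            not_false_eq_true, true_and, false_or]
        have e4 : (i.1 < k + 1) ↔ (i.1 < k) := by omega
        have e5 : (j.1 < k + 1) ↔ (j.1 < k) := by omega
        simp only [e1, e4, e5, mul_assoc]
  intro k hk
  rw [key k hk]
  rcases lt_or_gt_of_ne hij' with hlt | hlt <;> by_cases h1 : i.1 < k <;> by_cases h2 : j.1 < k
  all_goals
    first
    | omega
    | rw [if_pos h1, if_pos h2, if_neg (by omega), ← mul_assoc, htt, one_mul]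
    | rw [if_pos h1, if_neg h2, if_pos (by omega), one_mul]
    | rw [if_neg h1, if_pos h2, if_pos (by omega), one_mul]
    | rw [if_neg h1, if_neg h2, if_neg (by omega), one_mul, one_mul]

/-- Every position of a facet can be flipped. -/
theorem IsFacet.exists_isFlip {I : Finset (Fin Q.length)} (hI : C.IsFacet Q I)
    {i : Fin Q.length} (hi : i ∈ I) : ∃ J j, C.IsFlip Q I i J j := by
  have hβ := isRoot_rootFunction (C := C) I i
  -- Up to sign the root at `i` is positive, so its direction occurs outside `I`.
  obtain ⟨j, hj, c, hc, h⟩ : ∃ j ∉ I, ∃ c : ℝ, c ≠ 0 ∧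
      C.rootFunction Q I j = c • C.rootFunction Q I i := by
    rcases hβ.height_ne_zero.lt_or_gt with hneg | hpos
    · obtain ⟨j, hj, c, hc, h⟩ := hI.exists_eq_smul (hβ.smul (c := -1) (by norm_num))
        (by rw [height_smul]; linarith)
      refine ⟨j, hj, -c⁻¹, by simpa using hc.ne', ?_⟩
      rw [neg_smul, ← smul_neg, ← neg_one_smul ℝ, h, smul_smul, inv_mul_cancel₀ hc.ne', one_smul]
    · obtain ⟨j, hj, c, hc, h⟩ := hI.exists_eq_smul hβ hpos
      exact ⟨j, hj, c⁻¹, inv_ne_zero hc.ne', by rw [h, smul_smul, inv_mul_cancel₀ hc.ne', one_smul]⟩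
  have hij : i ≠ j := fun hij => hj (hij ▸ hi)
  have hij' : i.1 ≠ j.1 := fun h => hij (Fin.ext h)
  obtain ⟨t, ht, hprod⟩ := takeProd_exchange hi hj hc h
  have hcβ : C.rootFunction Q I i = c⁻¹ • C.rootFunction Q I j := by
    rw [h, smul_smul, inv_mul_cancel₀ hc, one_smul]
  -- Pulled back by the prefix at `i`, the root at `j` is `c` times a simple root, and its sign
  -- tells which of the two positions comes first.
  have hsign : (0 < c ∧ i.1 < j.1) ∨ (c < 0 ∧ j.1 < i.1) := by
    have h1 := hI.height_takeProd_inv_pos_iff hj i.2.le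
    rw [h, map_smul, takeProd_inv_rootFunction, height_smul] at h1
    have h2 := height_root (C := C) (Q.get i)
    rcases hc.lt_or_gt with hneg | hpos
    · refine Or.inr ⟨hneg, ?_⟩
      by_contra hle
      exact (h1.2 (by omega)).not_gt (mul_neg_of_neg_of_pos hneg h2)
    · have := h1.1 (mul_pos hpos h2)
      exact Or.inl ⟨hpos, by omega⟩
  -- On the range where prefixes are reflected, the root at `i` pulls back to a positive root, so it
  -- pairs nonnegatively with the weight vectors there.
  have hregion : ∀ k : Fin Q.length, (min i.1 j.1 < k.1 ∧ k.1 ≤ max i.1 j.1) →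
      0 < C.height ((((C.takeProd Q I k)⁻¹ : C.group) : V ≃ₗᵢ[ℝ] V) (C.rootFunction Q I i)) := by
    intro k hk
    have h1 := hI.height_takeProd_inv_pos_iff hj k.2.le
    rw [hcβ, map_smul, height_smul]
    rcases hsign with ⟨hpos, hlt⟩ | ⟨hneg, hlt⟩
    · exact mul_pos (inv_pos.2 hpos) (h1.2 (by omega))
    · refine mul_pos_of_neg_of_neg (inv_lt_zero.2 hneg)
        (((isRoot_rootFunction I j).map _).height_ne_zero.lt_or_gt.resolve_right fun h2 => ?_)
      have := h1.1 h2
      omega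
  have hroot : ∀ k : Fin Q.length, C.rootFunction Q (insert j (I.erase i)) k =
      if min i.1 j.1 < k.1 ∧ k.1 ≤ max i.1 j.1 then
        reflectionAlong (C.rootFunction Q I i) (C.rootFunction Q I k)
      else C.rootFunction Q I k := by
    intro k
    rw [rootFunction_eq, hprod k k.2.le, rootFunction_eq I k, ← ht]
    split_ifs <;> rfl
  have hweight : ∀ k : Fin Q.length, C.weightFunction Q (insert j (I.erase i)) k =
      if min i.1 j.1 < k.1 ∧ k.1 ≤ max i.1 j.1 then
        reflectionAlong (C.rootFunction Q I i) (C.weightFunction Q I k)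
      else C.weightFunction Q I k := by
    intro k
    rw [weightFunction_eq, hprod k k.2.le, weightFunction_eq I k, ← ht]
    split_ifs <;> rfl
  refine ⟨_, j, hi, hj, rfl, hI, ?_, ?_, ?_, ?_, ?_⟩
  · rw [isFacet_iff] at hI ⊢
    refine ⟨?_, ?_⟩
    · have hcard : (insert j (I.erase i)).card = I.card := by
        rw [Finset.card_insert_of_notMem (by simp [hj]), Finset.card_erase_add_one hi]
      rw [← hI.1, Finset.card_compl, Finset.card_compl, hcard]
    · rw [hprod _ le_rfl, if_neg (by omega), hI.2]
  · rw [hroot]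
    rcases hsign with ⟨hpos, hlt⟩ | ⟨hneg, hlt⟩
    · refine ⟨c, hpos, ?_⟩
      rw [if_pos (by omega), h, map_smul, reflectionAlong_self, smul_neg]
    · refine ⟨-c, neg_pos.2 hneg, ?_⟩
      rw [if_neg (by omega), h, neg_smul, neg_neg]
  · intro k
    rw [hroot]
    split_ifs
    · exact Or.inr rfl
    · exact Or.inl rfl
  · have hββ := real_inner_self_pos.2 hβ.1
    -- This is the multiple of the root at `i` that reflecting the `k`-th summand of the brick
    -- vector subtracts from it.
    set e : Fin Q.length → ℝ := fun k => if min i.1 j.1 < k.1 ∧ k.1 ≤ max i.1 j.1 then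
      2 * ⟪C.rootFunction Q I i, C.weightFunction Q I k⟫_ℝ /
        ⟪C.rootFunction Q I i, C.rootFunction Q I i⟫_ℝ else 0 with he
    refine ⟨∑ k, e k, ?_, ?_⟩
    · have hnn : ∀ k ∈ Finset.univ, 0 ≤ e k := by
        intro k _
        simp only [he]
        split_ifs with hk
        · refine div_nonneg (mul_nonneg zero_le_two ?_) hββ.le
          rw [weightFunction_eq, real_inner_comm, inner_coe_apply, real_inner_comm]
          exact (hβ.map _).inner_weight_nonneg (hregion k hk) _
        · exact le_rfl
      have hself : ∀ k, 0 < ⟪C.rootFunction Q I k, C.weightFunction Q I k⟫_ℝ := by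
        intro k
        rw [rootFunction_eq, weightFunction_eq, LinearIsometryEquiv.inner_map_map,
          inner_root_weight, if_pos rfl]
        exact half_pos (real_inner_self_pos.2 (C.root.ne_zero _))
      -- The later of the two positions lies in the reflected range and contributes a strictly
      -- positive term.
      rcases hsign with ⟨hpos, hlt⟩ | ⟨hneg, hlt⟩
      · refine Finset.sum_pos' hnn ⟨j, Finset.mem_univ _, ?_⟩
        simp only [he]
        rw [if_pos (by omega)]
        refine div_pos (mul_pos two_pos ?_) hββ
        have h1 := mul_pos (inv_pos.2 hpos) (hself j)
        rwa [hcβ, inner_smul_left, RCLike.conj_to_real]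
      · refine Finset.sum_pos' hnn ⟨i, Finset.mem_univ _, ?_⟩
        simp only [he]
        rw [if_pos (by omega)]
        exact div_pos (mul_pos two_pos (hself i)) hββ
    · rw [brickVector, brickVector, ← Finset.sum_sub_distrib, Finset.sum_smul]
      refine Finset.sum_congr rfl fun k _ => ?_
      rw [hweight]
      simp only [he]
      split_ifs
      · rw [reflectionAlong_apply, sub_sub_cancel]
      · rw [sub_self, zero_smul]
  · intro hneg
    rcases hsign with ⟨hpos, -⟩ | ⟨-, hlt⟩
    · have h1 := hI.height_pos hj
      rw [h, height_smul] at h1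
      exact absurd h1 (mul_neg_of_pos_of_neg hpos hneg).not_gt
    · exact hlt

/-- A facet containing `F` whose roots at the other positions are positive is unique. -/
theorem eq_of_height_pos {F I J : Finset (Fin Q.length)} (hI : C.IsFacet Q I)
    (hJ : C.IsFacet Q J) (hFI : F ⊆ I) (hFJ : F ⊆ J)
    (hIpos : ∀ k ∈ I, k ∉ F → 0 < C.height (C.rootFunction Q I k))
    (hJpos : ∀ k ∈ J, k ∉ F → 0 < C.height (C.rootFunction Q J k)) : I = J := by
  -- Outside `F`, the prefix product through `k` decides whether `k` belongs to the facet. Both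
  -- facets can therefore be rebuilt from the right end, where this product is the longest element.
  have step : ∀ {I : Finset (Fin Q.length)}, C.IsFacet Q I → F ⊆ I →
      (∀ k ∈ I, k ∉ F → 0 < C.height (C.rootFunction Q I k)) → ∀ k : Fin Q.length, k ∉ F →
      (k ∈ I ↔ 0 < C.height ((C.takeProd Q I (k + 1) : V ≃ₗᵢ[ℝ] V) (C.root (Q.get k)))) := by
    intro I hI hFI hpos k hkF
    constructor
    · intro hk
      rw [takeProd_succ_of_mem hk, ← rootFunction_eq]
      exact hpos k hk hkF
    · intro h
      by_contra hk
      rw [takeProd_succ_of_notMem hk, coe_mul_apply, simple_apply_root, map_neg, height_neg,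
        ← rootFunction_eq] at h
      linarith [hI.height_pos hk]
  have key : ∀ n k, k + n = Q.length → C.takeProd Q I k = C.takeProd Q J k ∧
      ∀ z : Fin Q.length, k ≤ z → (z ∈ I ↔ z ∈ J) := by
    intro n
    induction n with
    | zero =>
      rintro k rfl
      exact ⟨(isFacet_iff.1 hI).2.trans (isFacet_iff.1 hJ).2.symm, fun z hz => absurd z.2 (by omega)⟩
    | succ n ih =>
      intro k hk
      obtain ⟨h1, h2⟩ := ih (k + 1) (by omega)
      have hmem : (⟨k, by omega⟩ : Fin Q.length) ∈ I ↔ (⟨k, by omega⟩ : Fin Q.length) ∈ J := by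
        by_cases hkF : (⟨k, by omega⟩ : Fin Q.length) ∈ F
        · exact iff_of_true (hFI hkF) (hFJ hkF)
        · rw [step hI hFI hIpos _ hkF, step hJ hFJ hJpos _ hkF, h1]
      constructor
      · have e1 := takeProd_succ (C := C) I ⟨k, by omega⟩
        have e2 := takeProd_succ (C := C) J ⟨k, by omega⟩
        simp only at e1 e2
        have e3 : C.letterOutside Q I ⟨k, by omega⟩ = C.letterOutside Q J ⟨k, by omega⟩ := by
          simp only [letterOutside, hmem]
        rw [e1, e2, e3] at h1
        exact mul_right_cancel h1
      · intro z hz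
        rcases hz.eq_or_lt with hz | hz
        · have : z = ⟨k, by omega⟩ := Fin.ext hz.symm
          rw [this]
          exact hmem
        · exact h2 z hz
  ext z
  exact (key Q.length 0 (by omega)).2 z (Nat.zero_le _)

lemma IsFlip.subset {I J F : Finset (Fin Q.length)} {i j : Fin Q.length} (h : C.IsFlip Q I i J j)
    (hF : F ⊆ I) (hi : i ∉ F) : F ⊆ J := by
  rw [h.eq_insert]
  exact fun k hk => Finset.mem_insert_of_mem
    (Finset.mem_erase.2 ⟨fun hki => hi (hki ▸ hk), hF hk⟩)

/-- The facets containing `F` are connected by flips. -/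
theorem eq_of_isFlip_invariant {X : Type*} (f : Finset (Fin Q.length) → X)
    {F : Finset (Fin Q.length)}
    (hf : ∀ I i J j, C.IsFlip Q I i J j → F ⊆ I → i ∉ F → f I = f J)
    {I J : Finset (Fin Q.length)} (hI : C.IsFacet Q I) (hJ : C.IsFacet Q J) (hFI : F ⊆ I)
    (hFJ : F ⊆ J) : f I = f J := by
  -- Flipping a negative root outside `F` moves its position to the left, so the sum of positions
  -- decreases until all roots outside `F` are positive; that facet is unique.
  have key : ∀ n, ∀ I : Finset (Fin Q.length), ∑ i ∈ I, i.1 = n → C.IsFacet Q I → F ⊆ I →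
      ∃ I₀, C.IsFacet Q I₀ ∧ F ⊆ I₀ ∧
        (∀ k ∈ I₀, k ∉ F → 0 < C.height (C.rootFunction Q I₀ k)) ∧ f I = f I₀ := by
    intro n
    induction n using Nat.strong_induction_on with
    | _ n ih =>
      rintro I rfl hI hFI
      by_cases hpos : ∀ k ∈ I, k ∉ F → 0 < C.height (C.rootFunction Q I k)
      · exact ⟨I, hI, hFI, hpos, rfl⟩
      · push Not at hpos
        obtain ⟨i, hi, hiF, hle⟩ := hpos
        obtain ⟨J, j, hflip⟩ := hI.exists_isFlip hi
        have hlt := hflip.lt_of_height_neg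
          (hle.lt_of_ne (isRoot_rootFunction I i).height_ne_zero)
        have hsum : ∑ k ∈ J, k.1 < ∑ k ∈ I, k.1 := by
          rw [hflip.eq_insert, Finset.sum_insert (by simp [hflip.notMem]),
            ← Finset.add_sum_erase I _ hi]
          exact Nat.add_lt_add_right hlt _
        obtain ⟨I₀, h1, h2, h3, h4⟩ := ih _ hsum J rfl hflip.facet_right (hflip.subset hFI hiF)
        exact ⟨I₀, h1, h2, h3, (hf I i J j hflip hFI hiF).trans h4⟩
  obtain ⟨I₀, h1, h2, h3, h4⟩ := key _ I rfl hI hFI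
  obtain ⟨J₀, h5, h6, h7, h8⟩ := key _ J rfl hJ hFJ
  rw [h4, h8, eq_of_height_pos h1 h5 h2 h6 h3 h7]

end FiniteCoxeterSystem

end

noncomputable section

/-! ### Root configurations that are bases -/

namespace FiniteCoxeterSystem

variable {ι V : Type*} [NormedAddCommGroup V] [InnerProductSpace ℝ V]
  [Finite ι] [DecidableEq ι] {C : FiniteCoxeterSystem ι V} {Q : List ι}

lemma IsFlip.exists_root_eq_add {I J : Finset (Fin Q.length)} {i j : Fin Q.length}
    (h : C.IsFlip Q I i J j) (k : Fin Q.length) :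
    ∃ a : ℝ, C.rootFunction Q J k = C.rootFunction Q I k + a • C.rootFunction Q I i := by
  rcases h.root_eq_or k with h1 | h1
  · exact ⟨0, by rw [h1, zero_smul, add_zero]⟩
  · exact ⟨_, by rw [h1, reflectionAlong_apply, sub_eq_add_neg, ← neg_smul]⟩

lemma IsFlip.mem_right {I J : Finset (Fin Q.length)} {i j : Fin Q.length}
    (h : C.IsFlip Q I i J j) : j ∈ J := by
  rw [h.eq_insert]; exact Finset.mem_insert_self _ _

lemma IsFlip.notMem_right {I J : Finset (Fin Q.length)} {i j : Fin Q.length}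
    (h : C.IsFlip Q I i J j) : i ∉ J := by
  rw [h.eq_insert]
  simp only [Finset.mem_insert, Finset.mem_erase, ne_eq, not_true_eq_false, false_and, or_false]
  exact fun hij => h.notMem (hij ▸ h.mem)

lemma IsFlip.mem_right_iff {I J : Finset (Fin Q.length)} {i j k : Fin Q.length}
    (h : C.IsFlip Q I i J j) (hki : k ≠ i) (hkj : k ≠ j) : k ∈ J ↔ k ∈ I := by
  rw [h.eq_insert]
  simp [hki, hkj]

lemma IsFlip.eq_insert_left {I J : Finset (Fin Q.length)} {i j : Fin Q.length}
    (h : C.IsFlip Q I i J j) : I = insert i (J.erase j) := by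
  rw [h.eq_insert, Finset.erase_insert (by simp [h.notMem]), Finset.insert_erase h.mem]

/-- A flip changes the other roots by multiples of the root at `i`, and replaces that root by a
nonzero multiple of itself. -/
lemma IsFlip.span_eq {I J : Finset (Fin Q.length)} {i j : Fin Q.length}
    (h : C.IsFlip Q I i J j) :
    Submodule.span ℝ (C.rootFunction Q I '' I) = Submodule.span ℝ (C.rootFunction Q J '' J) := by
  obtain ⟨c, hc, hnew⟩ := h.root_new
  have hI : ∀ k ∈ I, C.rootFunction Q I k ∈ Submodule.span ℝ (C.rootFunction Q I '' I) :=
    fun k hk => Submodule.subset_span ⟨k, hk, rfl⟩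
  have hJ : ∀ k ∈ J, C.rootFunction Q J k ∈ Submodule.span ℝ (C.rootFunction Q J '' J) :=
    fun k hk => Submodule.subset_span ⟨k, hk, rfl⟩
  have hi : C.rootFunction Q I i ∈ Submodule.span ℝ (C.rootFunction Q J '' J) := by
    have h1 : C.rootFunction Q I i = (-c⁻¹) • C.rootFunction Q J j := by
      rw [hnew, neg_smul, smul_neg, neg_neg, smul_smul, inv_mul_cancel₀ hc.ne', one_smul]
    rw [h1]
    exact Submodule.smul_mem _ _ (hJ j h.mem_right)
  refine le_antisymm (Submodule.span_le.2 ?_) (Submodule.span_le.2 ?_)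
  · rintro _ ⟨k, hk, rfl⟩
    rcases eq_or_ne k i with rfl | hki
    · exact hi
    · have hkj : k ≠ j := fun hkj => h.notMem (hkj ▸ hk)
      obtain ⟨a, ha⟩ := h.exists_root_eq_add k
      rw [SetLike.mem_coe, ← sub_eq_iff_eq_add.2 ha]
      exact Submodule.sub_mem _ (hJ k ((h.mem_right_iff hki hkj).2 hk)) (Submodule.smul_mem _ _ hi)
  · rintro _ ⟨k, hk, rfl⟩
    rcases eq_or_ne k j with rfl | hkj
    · rw [hnew]
      exact Submodule.neg_mem _ (Submodule.smul_mem _ _ (hI i h.mem))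
    · have hki : k ≠ i := fun hki => h.notMem_right (hki ▸ hk)
      obtain ⟨a, ha⟩ := h.exists_root_eq_add k
      rw [ha]
      exact Submodule.add_mem _ (hI k ((h.mem_right_iff hki hkj).1 hk))
        (Submodule.smul_mem _ _ (hI i h.mem))

lemma finiteDimensional (C : FiniteCoxeterSystem ι V) : FiniteDimensional ℝ V :=
  Module.Finite.of_basis C.root

lemma IsFacet.card_eq {I J : Finset (Fin Q.length)} (hI : C.IsFacet Q I) (hJ : C.IsFacet Q J) :
    I.card = J.card := by
  have h1 := (isFacet_iff.1 hI).1.trans (isFacet_iff.1 hJ).1.symm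
  rw [Finset.card_compl, Finset.card_compl] at h1
  have h2 := Finset.card_le_univ I
  have h3 := Finset.card_le_univ J
  omega

lemma RootConfigurationIsBasis.card_eq {I : Finset (Fin Q.length)}
    (h : C.RootConfigurationIsBasis Q I) : I.card = Module.finrank ℝ V := by
  rw [Module.finrank_eq_card_basis (Module.Basis.mk h.1 h.2.ge), Fintype.card_coe]

/-- If one root configuration is a basis, then all of them are. -/
theorem IsRealizing.isBasis (hQ : C.IsRealizing Q) {I : Finset (Fin Q.length)}
    (hI : C.IsFacet Q I) : C.RootConfigurationIsBasis Q I := by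
  obtain ⟨J, hJ, hbasis⟩ := hQ
  have hspan := eq_of_isFlip_invariant (C := C) (Q := Q)
    (fun I => Submodule.span ℝ (C.rootFunction Q I '' I)) (F := ∅)
    (fun I i J j h _ _ => h.span_eq) hI hJ (by simp) (by simp)
  have hrange : ∀ I : Finset (Fin Q.length),
      C.rootFunction Q I '' I = Set.range fun i : I => C.rootFunction Q I i :=
    fun I => Set.image_eq_range _ _
  simp only [hrange] at hspan
  rw [hbasis.2] at hspan
  refine ⟨linearIndependent_of_top_le_span_of_card_eq_finrank hspan.ge ?_, hspan⟩
  rw [Fintype.card_coe, hI.card_eq hJ, hbasis.card_eq]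

/-! ### Dual vectors to the root configurations -/

/-- The vector `y` is dual to the root at `i` in the root configuration of `I`. -/
def IsDualVector (C : FiniteCoxeterSystem ι V) (Q : List ι) (I : Finset (Fin Q.length))
    (i : Fin Q.length) (y : V) : Prop :=
  ∀ k ∈ I, ⟪y, C.rootFunction Q I k⟫_ℝ = if k = i then 1 else 0

lemma RootConfigurationIsBasis.exists_isDualVector {I : Finset (Fin Q.length)}
    (h : C.RootConfigurationIsBasis Q I) {i : Fin Q.length} (hi : i ∈ I) :
    ∃ y, C.IsDualVector Q I i y := by
  have := C.finiteDimensional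
  set b := Module.Basis.mk h.1 h.2.ge with hb
  refine ⟨(InnerProductSpace.toDual ℝ V).symm (LinearMap.toContinuousLinearMap (b.coord ⟨i, hi⟩)),
    fun k hk => ?_⟩
  rw [InnerProductSpace.toDual_symm_apply]
  have h1 : C.rootFunction Q I k = b ⟨k, hk⟩ := by simp [hb]
  rw [h1]
  simp [Finsupp.single_apply]

/-- A vector dual to the root at `k ≠ i` is orthogonal to the root at `i`, so it does not see
multiples of that root being added. -/
lemma IsFlip.isDualVector_iff {I J : Finset (Fin Q.length)} {i j k : Fin Q.length}
    (h : C.IsFlip Q I i J j) (hk : k ∈ I) (hki : k ≠ i) (y : V) :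
    C.IsDualVector Q I k y ↔ C.IsDualVector Q J k y := by
  obtain ⟨c, hc, hnew⟩ := h.root_new
  have hkj : k ≠ j := fun hkj => h.notMem (hkj ▸ hk)
  have hzero : ⟪y, C.rootFunction Q J j⟫_ℝ = 0 ↔ ⟪y, C.rootFunction Q I i⟫_ℝ = 0 := by
    rw [hnew, inner_neg_right, inner_smul_right, neg_eq_zero, mul_eq_zero, or_iff_right hc.ne']
  have hsame : ⟪y, C.rootFunction Q I i⟫_ℝ = 0 → ∀ l, ⟪y, C.rootFunction Q J l⟫_ℝ =
      ⟪y, C.rootFunction Q I l⟫_ℝ := by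
    intro h0 l
    obtain ⟨a, ha⟩ := h.exists_root_eq_add l
    rw [ha, inner_add_right, inner_smul_right, h0, mul_zero, add_zero]
  constructor
  · intro hy l hl
    have h0 : ⟪y, C.rootFunction Q I i⟫_ℝ = 0 := by rw [hy i h.mem, if_neg hki.symm]
    rcases eq_or_ne l j with rfl | hlj
    · rw [hzero.2 h0, if_neg hkj.symm]
    · have hli : l ≠ i := fun hli => h.notMem_right (hli ▸ hl)
      rw [hsame h0, hy l ((h.mem_right_iff hli hlj).1 hl)]
  · intro hy l hl
    have h0 : ⟪y, C.rootFunction Q I i⟫_ℝ = 0 :=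
      hzero.1 (by rw [hy j h.mem_right, if_neg hkj.symm])
    rcases eq_or_ne l i with rfl | hli
    · rw [h0, if_neg hki.symm]
    · have hlj : l ≠ j := fun hlj => h.notMem (hlj ▸ hl)
      rw [← hsame h0, hy l ((h.mem_right_iff hli hlj).2 hl)]

lemma IsDualVector.of_mem {I J : Finset (Fin Q.length)} {i : Fin Q.length} {y : V}
    (h : C.IsDualVector Q I i y) (hI : C.IsFacet Q I) (hJ : C.IsFacet Q J) (hi : i ∈ I)
    (hi' : i ∈ J) : C.IsDualVector Q J i y := by
  have h1 := eq_of_isFlip_invariant (C := C) (Q := Q) (fun I => C.IsDualVector Q I i y) (F := {i})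
    (fun I k J j h hF hk => propext (h.isDualVector_iff (by simpa using hF)
      (by simpa [eq_comm] using hk) y)) hI hJ (by simpa using hi) (by simpa using hi')
  exact h1 ▸ h

open Classical in
/-- The vector dual to the roots at position `i` in all root configurations of facets
containing `i`. -/
def rayVector (C : FiniteCoxeterSystem ι V) (Q : List ι) (i : Fin Q.length) : V :=
  -- The default 0 only concerns positions without a dual vector; in the realizing case these lie in
  -- no facet and their ray plays no role.
  if h : ∃ y, ∃ I, C.IsFacet Q I ∧ i ∈ I ∧ C.IsDualVector Q I i y then h.choose else 0

lemma IsRealizing.isDualVector_rayVector (hQ : C.IsRealizing Q) {I : Finset (Fin Q.length)}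
    (hI : C.IsFacet Q I) {i : Fin Q.length} (hi : i ∈ I) :
    C.IsDualVector Q I i (C.rayVector Q i) := by
  have h : ∃ y, ∃ I, C.IsFacet Q I ∧ i ∈ I ∧ C.IsDualVector Q I i y := by
    obtain ⟨y, hy⟩ := (hQ.isBasis hI).exists_isDualVector hi
    exact ⟨y, I, hI, hi, hy⟩
  rw [rayVector, dif_pos h]
  obtain ⟨J, hJ, hiJ, hy⟩ := h.choose_spec
  exact hy.of_mem hJ hI hiJ hi

/-- The form in which linear independence is used: the dual vector at `j` tells `j` from `k`. -/
lemma IsRealizing.eq_of_root_smul (hQ : C.IsRealizing Q) {I : Finset (Fin Q.length)}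
    (hI : C.IsFacet Q I) {j k : Fin Q.length} (hj : j ∈ I) (hk : k ∈ I) {v : V} {a b : ℝ}
    (hb : b ≠ 0) (h1 : C.rootFunction Q I j = a • v)
    (h2 : C.rootFunction Q I k = b • v) : j = k := by
  by_contra hjk
  have h := hQ.isDualVector_rayVector hI hj
  have h3 := h j hj
  have h4 := h k hk
  rw [h1, inner_smul_right, if_pos rfl] at h3
  rw [h2, inner_smul_right, if_neg (Ne.symm hjk)] at h4
  rw [(mul_eq_zero.1 h4).resolve_left hb, mul_zero] at h3
  exact zero_ne_one h3

/-- A vector is the combination of the rays with coefficients given by the root configuration. -/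
lemma IsRealizing.eq_sum_rayVector (hQ : C.IsRealizing Q) {I : Finset (Fin Q.length)}
    (hI : C.IsFacet Q I) (y : V) :
    y = ∑ i ∈ I, ⟪y, C.rootFunction Q I i⟫_ℝ • C.rayVector Q i := by
  have h : Submodule.span ℝ (Set.range fun i : I => C.rootFunction Q I i) ≤
      (ℝ ∙ (y - ∑ i ∈ I, ⟪y, C.rootFunction Q I i⟫_ℝ • C.rayVector Q i))ᗮ := by
    rw [Submodule.span_le]
    rintro _ ⟨⟨k, hk⟩, rfl⟩
    rw [SetLike.mem_coe, Submodule.mem_orthogonal_singleton_iff_inner_right, inner_sub_left,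
      sum_inner, Finset.sum_congr rfl fun i hi => show _ = if k = i then
        ⟪y, C.rootFunction Q I i⟫_ℝ else 0 by
        rw [inner_smul_left, hQ.isDualVector_rayVector hI hi k hk]; simp]
    simp [hk]
  rw [(hQ.isBasis hI).2] at h
  have h2 := h (x := y - ∑ i ∈ I, ⟪y, C.rootFunction Q I i⟫_ℝ • C.rayVector Q i) trivial
  rw [Submodule.mem_orthogonal_singleton_iff_inner_right, inner_self_eq_zero, sub_eq_zero] at h2
  exact h2

/-! ### Uniqueness of the facet of a generic vector -/

/-- The root configuration of `I` lies in the image under `w` of the positive roots. -/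
def IsPositiveFor (C : FiniteCoxeterSystem ι V) (Q : List ι) (w : C.group)
    (I : Finset (Fin Q.length)) : Prop :=
  ∀ k ∈ I, 0 < C.height (((w⁻¹ : C.group) : V ≃ₗᵢ[ℝ] V) (C.rootFunction Q I k))

/-- A root which is positive for `w * s` and not for `w` is a negative multiple of `w (α s)`. -/
lemma IsRoot.eq_neg_smul {v : V} (hv : C.IsRoot v) {w : C.group} {s : ι}
    (h : 0 < C.height ((((w * C.simple s)⁻¹ : C.group) : V ≃ₗᵢ[ℝ] V) v))
    (h' : C.height (((w⁻¹ : C.group) : V ≃ₗᵢ[ℝ] V) v) < 0) :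
    ∃ c : ℝ, c < 0 ∧ v = c • (w : V ≃ₗᵢ[ℝ] V) (C.root s) := by
  have e : (((w * C.simple s)⁻¹ : C.group) : V ≃ₗᵢ[ℝ] V) v =
      (C.simple s : V ≃ₗᵢ[ℝ] V) (((w⁻¹ : C.group) : V ≃ₗᵢ[ℝ] V) v) := by
    rw [mul_inv_rev, simple_inv, coe_mul_apply]
  have e2 : (C.simple s : V ≃ₗᵢ[ℝ] V) ((((w * C.simple s)⁻¹ : C.group) : V ≃ₗᵢ[ℝ] V) v) =
      ((w⁻¹ : C.group) : V ≃ₗᵢ[ℝ] V) v := by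
    rw [e, ← coe_mul_apply, simple_mul_self, coe_one_apply]
  obtain ⟨c, hc, h1⟩ := (hv.map _).eq_smul_root h (s := s) (by rwa [e2])
  refine ⟨-c, neg_neg_of_pos hc, ?_⟩
  rw [h1, map_smul, simple_apply_root] at e2
  rw [← C.coe_apply_inv_self w v, ← e2, map_smul, map_neg, smul_neg, neg_smul]

/-- The positive systems of `w` and `w * s` differ only along the line of `w (α s)`. A basis has at
most one root on this line, and flipping it corrects the sign. -/
lemma IsRealizing.isPositiveFor_or_exists_isFlip (hQ : C.IsRealizing Q) {w : C.group} {s : ι}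
    {I : Finset (Fin Q.length)} (hI : C.IsFacet Q I) (h : C.IsPositiveFor Q (w * C.simple s) I) :
    C.IsPositiveFor Q w I ∨ ∃ i J j, C.IsFlip Q I i J j ∧ C.IsPositiveFor Q w J ∧
      (∃ c : ℝ, c < 0 ∧ C.rootFunction Q I i = c • (w : V ≃ₗᵢ[ℝ] V) (C.root s)) ∧
      ∃ c : ℝ, 0 < c ∧ C.rootFunction Q J j = c • (w : V ≃ₗᵢ[ℝ] V) (C.root s) := by
  by_cases hw : C.IsPositiveFor Q w I
  · exact Or.inl hw
  right
  simp only [IsPositiveFor, not_forall] at hw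
  obtain ⟨i, hi, hneg⟩ := hw
  have hneg' := ((isRoot_rootFunction I i).map _).height_ne_zero.lt_or_gt.resolve_right hneg
  obtain ⟨c, hc, hci⟩ := (isRoot_rootFunction I i).eq_neg_smul (h i hi) hneg'
  obtain ⟨J, j, hflip⟩ := hI.exists_isFlip hi
  obtain ⟨a, ha, hnew⟩ := hflip.root_new
  have hj : C.rootFunction Q J j = (-(a * c)) • (w : V ≃ₗᵢ[ℝ] V) (C.root s) := by
    rw [hnew, hci, smul_smul, neg_smul]
  have hac : 0 < -(a * c) := neg_pos.2 (mul_neg_of_pos_of_neg ha hc)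
  refine ⟨i, J, j, hflip, fun k hk => ?_, ⟨c, hc, hci⟩, ⟨_, hac, hj⟩⟩
  rcases eq_or_ne k j with rfl | hkj
  · rw [hj, map_smul, coe_inv_apply_self, height_smul]
    exact mul_pos hac (height_root s)
  · have hki : k ≠ i := fun hki => hflip.notMem_right (hki ▸ hk)
    have hkI := (hflip.mem_right_iff hki hkj).1 hk
    rcases hflip.root_eq_or k with h1 | h1
    · rw [h1]
      refine ((isRoot_rootFunction I k).map _).height_ne_zero.lt_or_gt.resolve_left fun h2 => ?_
      obtain ⟨b, hb, hbk⟩ := (isRoot_rootFunction I k).eq_neg_smul (h k hkI) h2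
      exact hki (hQ.eq_of_root_smul hI hkI hi hc.ne hbk hci)
    -- The reflection is `w s w⁻¹`, so pulling the reflected root back by `w` is the same as pulling
    -- the old root back by `w s`.
    · have h2 := h k hkI
      rw [h1, hci, reflectionAlong_smul hc.ne, ← coe_conj_simple, ← coe_mul_apply]
      rw [mul_inv_rev, simple_inv] at h2
      rwa [mul_assoc, inv_mul_cancel_left]

lemma IsPositiveFor.ne_smul {w : C.group} {s : ι} {I : Finset (Fin Q.length)}
    (h : C.IsPositiveFor Q (w * C.simple s) I) {k : Fin Q.length} (hk : k ∈ I) {c : ℝ}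
    (hc : 0 < c) : C.rootFunction Q I k ≠ c • (w : V ≃ₗᵢ[ℝ] V) (C.root s) := by
  intro h1
  have h2 := h k hk
  rw [h1, mul_inv_rev, simple_inv, coe_mul_apply, map_smul, coe_inv_apply_self, map_smul,
    simple_apply_root, height_smul, C.height_neg] at h2
  nlinarith [mul_pos hc (height_root (C := C) s)]

/-- This serves to recover `i`, which no longer belongs to `J`, from the direction of the root of
`J` there. -/
lemma IsFlip.exists_root_left_eq_smul {I J : Finset (Fin Q.length)} {i j : Fin Q.length}
    (h : C.IsFlip Q I i J j) : ∃ a : ℝ, a ≠ 0 ∧ C.rootFunction Q J i = a • C.rootFunction Q I i := by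
  rcases h.root_eq_or i with h1 | h1
  · exact ⟨1, one_ne_zero, by rw [h1, one_smul]⟩
  · exact ⟨-1, by norm_num, by rw [h1, reflectionAlong_self, neg_one_smul]⟩

/-- For each element `w` of the group, at most one root configuration lies in the image under `w`
of the positive roots. -/
theorem IsRealizing.eq_of_isPositiveFor (hQ : C.IsRealizing Q) (w : C.group)
    {I J : Finset (Fin Q.length)} (hI : C.IsFacet Q I) (hJ : C.IsFacet Q J)
    (hIw : C.IsPositiveFor Q w I) (hJw : C.IsPositiveFor Q w J) : I = J := by
  obtain ⟨l, rfl⟩ := exists_wordProd_eq w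
  induction l using List.reverseRecOn generalizing I J with
  | nil =>
    refine eq_of_height_pos (F := ∅) hI hJ (by simp) (by simp) (fun k hk _ => ?_) fun k hk _ => ?_
    · simpa [wordProd, coe_one_apply] using hIw k hk
    · simpa [wordProd, coe_one_apply] using hJw k hk
  | append_singleton l s ih =>
    have e : C.wordProd (l ++ [s]) = C.wordProd l * C.simple s := by
      rw [wordProd_append]; simp [wordProd]
    rw [e] at hIw hJw
    rcases hQ.isPositiveFor_or_exists_isFlip hI hIw with hI' | ⟨i, I', j, hIf, hI', hi, hj⟩ <;>
    rcases hQ.isPositiveFor_or_exists_isFlip hJ hJw with hJ' | ⟨i', J', j', hJf, hJ', hi', hj'⟩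
    · exact ih hI hJ hI' hJ'
    -- If only one facet needs a flip, the other one would contain a positive multiple of `w (α s)`,
    -- which is negative for `w s`.
    · obtain rfl := ih hI hJf.facet_right hI' hJ'
      obtain ⟨c, hc, h⟩ := hj'
      exact absurd h (hIw.ne_smul hJf.mem_right hc)
    · obtain rfl := ih hIf.facet_right hJ hI' hJ'
      obtain ⟨c, hc, h⟩ := hj
      exact absurd h (hJw.ne_smul hIf.mem_right hc)
    -- Both flips end at the same facet. The basis property identifies the new positions, and the
    -- uniqueness of root directions outside a facet identifies the old ones.
    · obtain rfl := ih hIf.facet_right hJf.facet_right hI' hJ'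
      obtain ⟨c, hc, h⟩ := hj
      obtain ⟨c', hc', h'⟩ := hj'
      obtain rfl := hQ.eq_of_root_smul hIf.facet_right hIf.mem_right hJf.mem_right hc'.ne' h h'
      obtain ⟨b, hb, hbi⟩ := hi
      obtain ⟨b', hb', hbi'⟩ := hi'
      obtain ⟨a, ha, hai⟩ := hIf.exists_root_left_eq_smul
      obtain ⟨a', ha', hai'⟩ := hJf.exists_root_left_eq_smul
      have hii : i = i' := by
        refine hIf.facet_right.eq_of_smul hIf.notMem_right hJf.notMem_right
          (c := a * b * (a' * b')⁻¹) ?_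
        rw [hai, hbi, hai', hbi', smul_smul, smul_smul, smul_smul,
          mul_assoc (a * b * (a' * b')⁻¹), inv_mul_cancel_right₀ (mul_ne_zero ha' hb'.ne)]
      rw [hIf.eq_insert_left, hJf.eq_insert_left, hii]

end FiniteCoxeterSystem

end

noncomputable section

/-! ### Maximal brick vectors -/

namespace FiniteCoxeterSystem

variable {ι V : Type*} [NormedAddCommGroup V] [InnerProductSpace ℝ V]
  [Finite ι] [DecidableEq ι] {C : FiniteCoxeterSystem ι V} {Q : List ι}

/-- A vector is generic if it lies on none of the reflecting hyperplanes of simple roots and their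
images. -/
def IsGeneric (C : FiniteCoxeterSystem ι V) (f : V) : Prop :=
  ∀ (w : C.group) (s : ι), ⟪f, (w : V ≃ₗᵢ[ℝ] V) (C.root s)⟫_ℝ ≠ 0

lemma IsGeneric.inner_rootFunction_ne_zero {f : V} (hf : C.IsGeneric f)
    (I : Finset (Fin Q.length)) (k : Fin Q.length) : ⟪f, C.rootFunction Q I k⟫_ℝ ≠ 0 := by
  rw [rootFunction_eq]
  exact hf _ _

lemma exists_isGeneric (C : FiniteCoxeterSystem ι V) : ∃ f, C.IsGeneric f := by
  obtain ⟨f, hf⟩ := Module.Dual.exists_forall_ne_zero_of_forall_exists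
    (fun a : C.group × ι => innerₗ V ((a.1 : V ≃ₗᵢ[ℝ] V) (C.root a.2)))
    (fun a => ⟨(a.1 : V ≃ₗᵢ[ℝ] V) (C.root a.2),
      inner_self_ne_zero.2 ((isRoot_root a.2).map a.1).1⟩)
  refine ⟨f, fun w s => ?_⟩
  rw [real_inner_comm]
  exact hf (w, s)

open Filter Topology in
lemma tendsto_inner_add_smul (f g v : V) :
    Tendsto (fun ε : ℝ => ⟪f + ε • g, v⟫_ℝ) (𝓝[>] 0) (𝓝 ⟪f, v⟫_ℝ) := by
  have h : Continuous fun ε : ℝ => ⟪f + ε • g, v⟫_ℝ := by fun_prop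
  have h1 := (h.tendsto 0).mono_left (nhdsWithin_le_nhds (s := Set.Ioi 0))
  simpa using h1

-- There are finitely many roots `w (α s)`: nonzero pairings with `f` survive a small perturbation,
-- and where `f` vanishes the generic `g` takes over.
open Filter Topology in
lemma IsGeneric.eventually {g : V} (hg : C.IsGeneric g) (f : V) :
    ∀ᶠ ε : ℝ in 𝓝[>] 0, 0 < ε ∧ C.IsGeneric (f + ε • g) ∧ ∀ (w : C.group) (s : ι),
      0 < ⟪f, (w : V ≃ₗᵢ[ℝ] V) (C.root s)⟫_ℝ →
        0 < ⟪f + ε • g, (w : V ≃ₗᵢ[ℝ] V) (C.root s)⟫_ℝ := by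
  have h0 : ∀ᶠ ε : ℝ in 𝓝[>] 0, 0 < ε := self_mem_nhdsWithin
  refine h0.and (Eventually.and ?_ ?_)
  · refine eventually_all.2 fun w => eventually_all.2 fun s => ?_
    by_cases h : ⟪f, (w : V ≃ₗᵢ[ℝ] V) (C.root s)⟫_ℝ = 0
    · filter_upwards [h0] with ε hε
      rw [inner_add_left, h, zero_add, inner_smul_left]
      exact mul_ne_zero hε.ne' (hg w s)
    · exact (tendsto_inner_add_smul f g _).eventually_ne h
  · refine eventually_all.2 fun w => eventually_all.2 fun s => ?_
    by_cases h : 0 < ⟪f, (w : V ≃ₗᵢ[ℝ] V) (C.root s)⟫_ℝ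
    · filter_upwards [(tendsto_inner_add_smul f g _).eventually_const_lt h] with ε hε _ using hε
    · exact Eventually.of_forall fun ε h1 => absurd h1 h

/-- A generic vector lies in the image of the fundamental chamber under some group element. -/
lemma IsGeneric.exists_chamber {f : V} (hf : C.IsGeneric f) :
    ∃ w : C.group, ∀ s, 0 < ⟪C.root s, ((w⁻¹ : C.group) : V ≃ₗᵢ[ℝ] V) f⟫_ℝ := by
  -- In the orbit of the chamber point, take the point pairing best with `f`; crossing a wall from
  -- there cannot increase the pairing.
  obtain ⟨w, hw⟩ := Finite.exists_max
    fun w : C.group => ⟪(w : V ≃ₗᵢ[ℝ] V) C.chamberPoint, f⟫_ℝ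
  refine ⟨w, fun s => ?_⟩
  have h := hw (w * C.simple s)
  rw [coe_mul_apply, coe_simple, reflectionAlong_apply, map_sub, map_smul, inner_sub_left,
    inner_smul_left, RCLike.conj_to_real] at h
  rw [← inner_coe_apply]
  have hc : 0 < 2 * ⟪C.root s, C.chamberPoint⟫_ℝ / ⟪C.root s, C.root s⟫_ℝ :=
    div_pos (mul_pos two_pos (inner_root_chamberPoint s))
      (real_inner_self_pos.2 (C.root.ne_zero s))
  have hne := hf w s
  rw [real_inner_comm] at hne
  refine lt_of_le_of_ne ?_ hne.symm
  exact nonneg_of_mul_nonneg_right (by linarith) hc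

/-- A generic vector is positive on at most one root configuration. -/
lemma IsRealizing.eq_of_isGeneric (hQ : C.IsRealizing Q) {f : V} (hf : C.IsGeneric f)
    {I J : Finset (Fin Q.length)} (hI : C.IsFacet Q I) (hJ : C.IsFacet Q J)
    (hIf : ∀ k ∈ I, 0 < ⟪f, C.rootFunction Q I k⟫_ℝ)
    (hJf : ∀ k ∈ J, 0 < ⟪f, C.rootFunction Q J k⟫_ℝ) : I = J := by
  obtain ⟨w, hw⟩ := hf.exists_chamber
  have key : ∀ I : Finset (Fin Q.length), (∀ k ∈ I, 0 < ⟪f, C.rootFunction Q I k⟫_ℝ) →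
      C.IsPositiveFor Q w I := by
    intro I hI k hk
    have hroot := (isRoot_rootFunction (C := C) I k).map w⁻¹
    refine hroot.height_ne_zero.lt_or_gt.resolve_left fun h => ?_
    have h1 := (hroot.smul (c := -1) (by norm_num)).inner_pos
      (by rw [height_smul]; linarith) hw
    rw [inner_smul_left, inner_coe_apply, inv_inv, coe_apply_inv_self, real_inner_comm,
      RCLike.conj_to_real] at h1
    linarith [hI k hk]
  exact hQ.eq_of_isPositiveFor w hI hJ (key I hIf) (key J hJf)

/-- If the brick vector of a facet maximizes a functional among those of the facets containing `F`,
then the functional is nonnegative on the roots at the positions outside `F`. -/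
lemma IsFacet.inner_rootFunction_nonneg {f : V} {I F : Finset (Fin Q.length)}
    (hI : C.IsFacet Q I) (hFI : F ⊆ I) (h : ∀ J, C.IsFacet Q J → F ⊆ J →
      ⟪f, C.brickVector Q J⟫_ℝ ≤ ⟪f, C.brickVector Q I⟫_ℝ) {i : Fin Q.length} (hi : i ∈ I)
    (hiF : i ∉ F) : 0 ≤ ⟪f, C.rootFunction Q I i⟫_ℝ := by
  obtain ⟨J, j, hflip⟩ := hI.exists_isFlip hi
  obtain ⟨d, hd, hB⟩ := hflip.brick
  have h1 := h J hflip.facet_right (hflip.subset hFI hiF)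
  rw [← sub_nonneg, ← inner_sub_right, hB, inner_smul_right] at h1
  exact nonneg_of_mul_nonneg_right h1 hd

/-- Among the facets containing a given set, there is one whose brick vector maximizes a
functional. -/
lemma IsFacet.exists_maximizer {I F : Finset (Fin Q.length)} (hI : C.IsFacet Q I) (hFI : F ⊆ I)
    (f : V) : ∃ J, C.IsFacet Q J ∧ F ⊆ J ∧ ∀ J', C.IsFacet Q J' → F ⊆ J' →
      ⟪f, C.brickVector Q J'⟫_ℝ ≤ ⟪f, C.brickVector Q J⟫_ℝ := by
  obtain ⟨J, hJ, hmax⟩ := Set.exists_max_image {J | C.IsFacet Q J ∧ F ⊆ J}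
    (fun J => ⟪f, C.brickVector Q J⟫_ℝ) (Set.toFinite _) ⟨I, hI, hFI⟩
  exact ⟨J, hJ.1, hJ.2, fun J' h1 h2 => hmax J' ⟨h1, h2⟩⟩

/-- The sum of the rays of `I` pairs to 1 with each root of `I`, and a small generic perturbation
keeps these pairings positive. -/
lemma IsRealizing.exists_isGeneric_pos (hQ : C.IsRealizing Q) {I : Finset (Fin Q.length)}
    (hI : C.IsFacet Q I) : ∃ g, C.IsGeneric g ∧ ∀ k ∈ I, 0 < ⟪g, C.rootFunction Q I k⟫_ℝ := by
  obtain ⟨h, hh⟩ := C.exists_isGeneric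
  obtain ⟨ε, -, hgen, hpos⟩ := (hh.eventually (∑ i ∈ I, C.rayVector Q i)).exists
  refine ⟨_, hgen, fun k hk => ?_⟩
  rw [rootFunction_eq]
  refine hpos _ _ ?_
  rw [← rootFunction_eq, sum_inner,
    Finset.sum_congr rfl fun i hi => hQ.isDualVector_rayVector hI hi k hk]
  simp [hk]

/-- A functional which is nonnegative on the root configuration of a facet is maximized by its
brick vector. -/
theorem IsRealizing.inner_brickVector_le (hQ : C.IsRealizing Q) {f : V}
    {I J : Finset (Fin Q.length)} (hI : C.IsFacet Q I) (hJ : C.IsFacet Q J)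
    (hf : ∀ k ∈ I, 0 ≤ ⟪f, C.rootFunction Q I k⟫_ℝ) :
    ⟪f, C.brickVector Q J⟫_ℝ ≤ ⟪f, C.brickVector Q I⟫_ℝ := by
  -- After perturbation by a generic `g` positive on `I`, any maximizing facet must be `I` by
  -- uniqueness. The claim follows as `ε` tends to 0.
  obtain ⟨g, hg, hgpos⟩ := hQ.exists_isGeneric_pos hI
  refine le_of_tendsto_of_tendsto (tendsto_inner_add_smul f g _) (tendsto_inner_add_smul f g _) ?_
  filter_upwards [hg.eventually f] with ε hε
  obtain ⟨hε0, hgen, -⟩ := hε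
  obtain ⟨M, hM, -, hmax⟩ := hI.exists_maximizer (Finset.empty_subset I) (f + ε • g)
  have hMI : M = I := by
    refine hQ.eq_of_isGeneric hgen hM hI (fun k hk => ?_) fun k hk => ?_
    · exact lt_of_le_of_ne (hM.inner_rootFunction_nonneg (Finset.empty_subset M) hmax hk (by simp))
        (hgen.inner_rootFunction_ne_zero M k).symm
    · rw [inner_add_left, inner_smul_left]
      exact add_pos_of_nonneg_of_pos (hf k hk) (mul_pos hε0 (hgpos k hk))
  rw [← hMI]
  exact hmax J hJ (Finset.empty_subset J)

lemma IsRealizing.inner_rayVector_nonneg (hQ : C.IsRealizing Q) {I : Finset (Fin Q.length)}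
    (hI : C.IsFacet Q I) {i : Fin Q.length} (hi : i ∈ I) :
    ∀ k ∈ I, 0 ≤ ⟪C.rayVector Q i, C.rootFunction Q I k⟫_ℝ := by
  intro k hk
  rw [hQ.isDualVector_rayVector hI hi k hk]
  split_ifs <;> norm_num

lemma IsRealizing.inner_rayVector_le (hQ : C.IsRealizing Q) {I J : Finset (Fin Q.length)}
    (hI : C.IsFacet Q I) (hJ : C.IsFacet Q J) {i : Fin Q.length} (hi : i ∈ I) :
    ⟪C.rayVector Q i, C.brickVector Q J⟫_ℝ ≤ ⟪C.rayVector Q i, C.brickVector Q I⟫_ℝ :=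
  hQ.inner_brickVector_le hI hJ (hQ.inner_rayVector_nonneg hI hi)

/-- The facets whose brick vectors maximize the functional of the ray at `i` contain `i`. -/
lemma IsRealizing.mem_of_inner_rayVector_eq (hQ : C.IsRealizing Q) {I J : Finset (Fin Q.length)}
    (hI : C.IsFacet Q I) (hJ : C.IsFacet Q J) {i : Fin Q.length} (hi : i ∈ I)
    (h : ⟪C.rayVector Q i, C.brickVector Q J⟫_ℝ = ⟪C.rayVector Q i, C.brickVector Q I⟫_ℝ) :
    i ∈ J := by
  obtain ⟨g, hg, hgpos⟩ := hQ.exists_isGeneric_pos hJ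
  obtain ⟨ε, hε0, hgen, hpos⟩ := (hg.eventually (C.rayVector Q i)).exists
  -- The maximum is taken only over facets containing `i`. Flips keeping `i` control the other roots
  -- of `M`, while the root at `i` pairs to 1 with the ray. Thus the perturbed functional is
  -- positive on both `M` and `J`, and the two agree.
  obtain ⟨M, hM, hiM, hmax⟩ := hI.exists_maximizer (F := {i}) (by simpa using hi)
    (C.rayVector Q i + ε • g)
  have hiM' : i ∈ M := by simpa using hiM
  have hMJ : M = J := by
    refine hQ.eq_of_isGeneric hgen hM hJ (fun k hk => ?_) fun k hk => ?_
    · rcases eq_or_ne k i with rfl | hki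
      · rw [rootFunction_eq]
        refine hpos _ _ ?_
        rw [← rootFunction_eq, hQ.isDualVector_rayVector hM hk k hk, if_pos rfl]
        exact one_pos
      · exact lt_of_le_of_ne (hM.inner_rootFunction_nonneg hiM hmax hk (by simpa using hki))
          (hgen.inner_rootFunction_ne_zero M k).symm
    · rw [inner_add_left, inner_smul_left]
      refine add_pos_of_nonneg_of_pos ?_ (mul_pos hε0 (hgpos k hk))
      refine hJ.inner_rootFunction_nonneg (Finset.empty_subset J) (fun J' hJ' _ => ?_) hk (by simp)
      rw [h]
      exact hQ.inner_rayVector_le hI hJ' hi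
  exact hMJ ▸ hiM'

lemma IsRealizing.exists_height (hQ : C.IsRealizing Q) :
    ∃ h : Fin Q.length → ℝ, ∀ I, C.IsFacet Q I → ∀ i ∈ I,
      ⟪C.rayVector Q i, C.brickVector Q I⟫_ℝ = h i := by
  have key : ∀ i, ∃ a, ∀ I, C.IsFacet Q I → i ∈ I →
      ⟪C.rayVector Q i, C.brickVector Q I⟫_ℝ = a := by
    intro i
    by_cases h : ∃ I, C.IsFacet Q I ∧ i ∈ I
    · obtain ⟨I, hI, hi⟩ := h
      exact ⟨_, fun J hJ hj =>
        le_antisymm (hQ.inner_rayVector_le hI hJ hi) (hQ.inner_rayVector_le hJ hI hj)⟩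
    · exact ⟨0, fun I hI hi => absurd ⟨I, hI, hi⟩ h⟩
  choose a ha using key
  exact ⟨a, fun I hI i hi => ha i I hI hi⟩

/-- The brick polytope of a realizing word, with its normal fan. -/
def IsRealizing.fanPolytope (hQ : C.IsRealizing Q) : SimplicialFanPolytope (Fin Q.length) V where
  facets := {I | C.IsFacet Q I}
  point := C.brickVector Q
  ray := C.rayVector Q
  height := hQ.exists_height.choose
  nonempty := ⟨hQ.choose, hQ.choose_spec.1⟩
  card_eq := fun I hI => (hQ.isBasis hI).card_eq
  span_eq := fun I hI => by
    refine eq_top_iff.2 fun y _ => ?_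
    rw [hQ.eq_sum_rayVector hI y]
    exact Submodule.sum_mem _ fun i hi =>
      Submodule.smul_mem _ _ (Submodule.subset_span ⟨i, hi, rfl⟩)
  le_height := fun I hI i hi J hJ => by
    rw [← hQ.exists_height.choose_spec I hI i hi]
    exact hQ.inner_rayVector_le hI hJ hi
  eq_height_iff := fun I hI i hi J hJ => by
    refine ⟨fun h => ?_, fun h => hQ.exists_height.choose_spec J hJ i h⟩
    rw [← hQ.exists_height.choose_spec I hI i hi] at h
    exact hQ.mem_of_inner_rayVector_eq hI hJ hi h
  exists_cone := fun y => by
    obtain ⟨I, hI, -, hmax⟩ := hQ.choose_spec.1.exists_maximizer (Finset.empty_subset _) y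
    -- The coefficients are already nonnegative on the maximizing facet; the maximum with 0 only
    -- matters at the other positions.
    refine ⟨I, hI, fun i => max 0 ⟪y, C.rootFunction Q I i⟫_ℝ, fun i => le_max_left _ _, ?_⟩
    conv_lhs => rw [hQ.eq_sum_rayVector hI y]
    refine Finset.sum_congr rfl fun i hi => ?_
    dsimp only
    rw [max_eq_right (hI.inner_rootFunction_nonneg (Finset.empty_subset I) hmax hi (by simp))]
  exists_notMem := fun I hI G hG i hi => by
    by_cases hiI : i ∈ I
    · obtain ⟨J, j, hflip⟩ := IsFacet.exists_isFlip hI hiI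
      exact ⟨J, hflip.facet_right, hflip.subset hG hi, hflip.notMem_right⟩
    · exact ⟨I, hI, hG, hiI⟩

lemma IsRealizing.faces_fanPolytope (hQ : C.IsRealizing Q) :
    hQ.fanPolytope.faces = C.sphericalSubwordComplex Q :=
  Set.ext fun _ => mem_sphericalSubwordComplex_iff.symm

end FiniteCoxeterSystem

end

/-! ### The main theorem -/

theorem mainTheorem1 {ι V : Type*} [Finite ι] [DecidableEq ι]
    [NormedAddCommGroup V] [InnerProductSpace ℝ V]
    (C : FiniteCoxeterSystem ι V) (Q : List ι)
    (hQ : C.demazure Q = C.longest)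
    (hreal : C.IsRealizing Q) :
    -- the root configuration of every facet is a basis
    (∀ I, C.IsFacet Q I → C.RootConfigurationIsBasis Q I) ∧
    -- the polar of the brick polytope, taken at any interior point, realizes `SC(Q)`
    (interior (C.brickPolytope Q)).Nonempty ∧
    (∀ p ∈ interior (C.brickPolytope Q),
      RealizesComplex (polarAt (C.brickPolytope Q) p) (C.sphericalSubwordComplex Q)) ∧
    -- every brick vector is a vertex, and the brick polytope is simple
    (∀ I, C.IsFacet Q I → C.brickVector Q I ∈ (C.brickPolytope Q).extremePoints ℝ) ∧
    IsSimplePolytope (C.brickPolytope Q) ∧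
    -- the face poset of the brick polytope is dual to that of `SC(Q)`, facets of `SC(Q)`
    -- corresponding to their brick vectors
    (∃ e : (C.sphericalSubwordComplex Q) ≃o (NonemptyFace (C.brickPolytope Q))ᵒᵈ,
      ∀ I : C.sphericalSubwordComplex Q, C.IsFacet Q I.1 →
        (OrderDual.ofDual (e I)).1 = {C.brickVector Q I.1}) := by
  have := C.finiteDimensional
  refine ⟨fun I hI => hreal.isBasis hI, hreal.fanPolytope.interior_polytope_nonempty,
    fun p hp => ?_, fun I hI => SimplicialFanPolytope.point_mem_extremePoints
      (D := hreal.fanPolytope) hI, SimplicialFanPolytope.isSimplePolytope (D := hreal.fanPolytope),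
    (OrderIso.setCongr _ _ hreal.faces_fanPolytope.symm).trans hreal.fanPolytope.faceOrderIso,
    fun I hI => SimplicialFanPolytope.face_facet (D := hreal.fanPolytope) hI⟩
  rw [← hreal.faces_fanPolytope]
  exact SimplicialFanPolytope.realizesComplex (D := hreal.fanPolytope) hp
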